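/- Let $\pi\colon E\to M$ be a smooth fibre bundle over an $m$-dimensional manifold $M$, with $\dim E=m+n$ (manifolds are real, Hausdorff, second countable and $C^\infty$), let $\omega$ be a volume form on $M$ (a smooth nowhere vanishing $m$-form), and let $\pi^k_s\colon J^k\pi\to J^s\pi$ ($s\le k$) be the natural projections of the jet manifolds of $\pi$. Call adapted coordinates $(x^i,u^\alpha)$ of $E$ *natural* if $\omega=\mathrm d x^1\wedge\dots\wedge \mathrm d x^m=:\mathrm d^mx$; they induce coordinates $u^\alpha_I$ of $J^k\pi$ ($I\in\mathbb N^m$, $|I|\le k$) given by $u^\alpha_I(j^k_x\phi)=\partial^{|I|}(u^\alpha\circ\phi)/\partial x^I(x)$. Let $1_i$ be the $i$-th unit multi-index, $u^\alpha_i=u^\alpha_{1_i}$, $n(ii)=1$ and $n(ij)=2$ for $i\ne j$; for a function $f$ of the coordinates of $J^k\pi$ let $$D_if=\frac{\partial f}{\partial x^i}+\sum_{\alpha}\sum_{|I|\le k}u^\alpha_{I+1_i}\frac{\partial f}{\partial u^\alpha_I}.$$ Let $L\in C^\infty(J^2\pi)$ be a second-order Lagrangian function, and in natural coordinates put $$L^{ij}_\alpha=\frac1{n(ij)}\frac{\partial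 L}{\partial u^\alpha_{1_i+1_j}},\qquad L^i_\alpha=\frac{\partial L}{\partial u^\alpha_i}-\sum_jD_jL^{ij}_\alpha .$$ Let $\Theta_{\mathcal L}\in\Omega^m(J^3\pi)$ be the Poincaré–Cartan form of $\mathcal L=L\,\omega$, i.e. the $m$-form given in all natural coordinates by $$\Theta_{\mathcal L}=\sum_{\alpha,i} L^i_\alpha\,\mathrm du^\alpha\wedge \mathrm d^{m-1}x_i+\sum_{\alpha,i,j}L^{ij}_\alpha\,\mathrm du^\alpha_i\wedge \mathrm d^{m-1}x_j+\Bigl(L-\sum_{\alpha,i}L^i_\alpha u^\alpha_i-\sum_{\alpha,i,j}L^{ij}_\alpha u^\alpha_{1_i+1_j}\Bigr)\mathrm d^mx,$$ where $\mathrm d^{m-1}x_i=i(\partial/\partial x^i)\,\mathrm d^mx$. Let $s\in\{1,2\}$. A smooth vector field $X$ on $J^3\pi$ is $\pi^3_s$-vertical if $T\pi^3_s\circ X=0$. The following conditions are equivalent: 1. $\Theta_{\mathcal L}$ projects onto $J^s\pi$, i.e. $i(X)\Theta_{\mathcal L}=0$ and $\mathrm L(X)\Theta_{\mathcal L}=0$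 for every $\pi^3_s$-vertical vector field $X$ on $J^3\pi$. 2. $\mathrm d\Theta_{\mathcal L}$ is $\pi^3_s$-semibasic, i.e. $i(X)\,\mathrm d\Theta_{\mathcal L}=0$ for every $\pi^3_s$-vertical vector field $X$ on $J^3\pi$. 3. $\mathrm L(X)L^i_\alpha=0$ and $\mathrm L(X)L^{ij}_\alpha=0$ for every $\pi^3_s$-vertical vector field $X$ on $J^3\pi$, all $i,j,\alpha$, and on the domain of every system of natural coordinates. -/

import Mathlib

open Set Filter Topology
open scoped Manifold ContDiff

noncomputable section

universe u v

/-! ### Multi-indices and partial derivatives in `ℝ^m` -/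

/-- Multi-indices `I ∈ ℕ^m` of length `|I| ≤ k`. -/
abbrev MultiIndex (m k : ℕ) : Type := {I : Fin m → ℕ // ∑ i, I i ≤ k}

instance MultiIndex.instFinite (m k : ℕ) : Finite (MultiIndex m k) :=
  Finite.of_injective
    (fun I : MultiIndex m k => fun i : Fin m =>
      (⟨I.1 i, Nat.lt_succ_of_le
        ((Finset.single_le_sum (fun j _ => Nat.zero_le (I.1 j)) (Finset.mem_univ i)).trans I.2)⟩ :
        Fin (k + 1)))
    (fun _ _ h => Subtype.ext (funext fun i => congrArg Fin.val (congrFun h i)))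

instance MultiIndex.instFintype (m k : ℕ) : Fintype (MultiIndex m k) := Fintype.ofFinite _

/-- The partial derivative `∂f/∂x^i`. -/
def partialDeriv {m : ℕ} {V : Type*} [NormedAddCommGroup V] [NormedSpace ℝ V]
    (i : Fin m) (f : (Fin m → ℝ) → V) : (Fin m → ℝ) → V :=
  fun x => fderiv ℝ f x (Pi.single i 1)

/-- Iterated partial derivatives along a list of directions. -/
def iterPartial {m : ℕ} {V : Type*} [NormedAddCommGroup V] [NormedSpace ℝ V]
    (l : List (Fin m)) (f : (Fin m → ℝ) → V) : (Fin m → ℝ) → V :=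
  l.foldr partialDeriv f

/-- The list of directions `1, …, 1, 2, …, 2, …, m, …, m` in which `i` occurs `I i` times. -/
def directions {m : ℕ} (I : Fin m → ℕ) : List (Fin m) :=
  (List.finRange m).flatMap fun i => List.replicate (I i) i

/-- The partial derivative `∂^{|I|}f/∂x^I` for a multi-index `I`. -/
def multiDeriv {m : ℕ} {V : Type*} [NormedAddCommGroup V] [NormedSpace ℝ V]
    (I : Fin m → ℕ) (f : (Fin m → ℝ) → V) : (Fin m → ℝ) → V :=
  iterPartial (directions I) f

section Calculus

variable {m : ℕ} {V : Type*} [NormedAddCommGroup V] [NormedSpace ℝ V]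

theorem count_directions (I : Fin m → ℕ) (i : Fin m) : (directions I).count i = I i := by
  simp only [directions, List.count_flatMap]
  rw [← Fin.sum_univ_def]
  simp [List.count_replicate]

theorem length_directions (I : Fin m → ℕ) : (directions I).length = ∑ i, I i := by
  simp [directions, List.length_flatMap, Fin.sum_univ_def]

theorem perm_directions (l : List (Fin m)) : l.Perm (directions fun i => l.count i) :=
  List.perm_iff_count.2 fun i => (count_directions (fun i => l.count i) i).symm

theorem iterPartial_contDiffOn {f : (Fin m → ℝ) → V} {U : Set (Fin m → ℝ)} (hU : IsOpen U)
    (hf : ContDiffOn ℝ ∞ f U) (l : List (Fin m)) : ContDiffOn ℝ ∞ (iterPartial l f) U := by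
  induction l with
  | nil => exact hf
  | cons i l ih =>
    exact (ih.fderiv_of_isOpen hU (by simp)).clm_apply contDiffOn_const

theorem iterPartial_eventuallyEq {f g : (Fin m → ℝ) → V} {x : Fin m → ℝ}
    (h : f =ᶠ[𝓝 x] g) (l : List (Fin m)) : iterPartial l f =ᶠ[𝓝 x] iterPartial l g := by
  induction l with
  | nil => exact h
  | cons i l ih =>
    filter_upwards [ih.fderiv (𝕜 := ℝ)] with y hy
    change fderiv ℝ (iterPartial l f) y _ = fderiv ℝ (iterPartial l g) y _
    rw [hy]

theorem iterPartial_eq {f : (Fin m → ℝ) → V} {U : Set (Fin m → ℝ)} (hU : IsOpen U)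
    (hf : ContDiffOn ℝ ∞ f U) (l : List (Fin m)) {x : Fin m → ℝ} (hx : x ∈ U) :
    iterPartial l f x =
      iteratedFDeriv ℝ l.length f x (fun j => Pi.single (l.get j) (1 : ℝ)) := by
  induction l generalizing x with
  | nil => simp [iterPartial]
  | cons i l ih =>
    have h1 : iterPartial l f =ᶠ[𝓝 x] fun y =>
        iteratedFDeriv ℝ l.length f y (fun j => Pi.single (l.get j) (1 : ℝ)) :=
      Filter.eventually_of_mem (hU.mem_nhds hx) fun y hy => ih hy
    have h2 : DifferentiableAt ℝ (iteratedFDeriv ℝ l.length f) x :=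
      ((hf.contDiffAt (hU.mem_nhds hx)).differentiableAt_iteratedFDeriv
        (by exact_mod_cast WithTop.coe_lt_coe.2 (ENat.natCast_lt_top _)))
    change fderiv ℝ (iterPartial l f) x (Pi.single i 1) = _
    rw [h1.fderiv_eq]
    have h3 : fderiv ℝ (fun y =>
        iteratedFDeriv ℝ l.length f y (fun j => Pi.single (l.get j) (1 : ℝ))) x
        (Pi.single i (1 : ℝ)) = fderiv ℝ (iteratedFDeriv ℝ l.length f) x (Pi.single i (1 : ℝ))
          (fun j => Pi.single (l.get j) (1 : ℝ)) := by
      rw [fderiv_continuousMultilinear_apply_const_apply h2]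
    rw [h3]
    rfl

theorem iterPartial_perm {f : (Fin m → ℝ) → V} {U : Set (Fin m → ℝ)} (hU : IsOpen U)
    (hf : ContDiffOn ℝ ∞ f U) {l l' : List (Fin m)} (h : l.Perm l') :
    EqOn (iterPartial l f) (iterPartial l' f) U := by
  induction h with
  | nil => exact fun x _ => rfl
  | @cons i l₁ l₂ _ ih =>
    intro x hx
    change fderiv ℝ (iterPartial l₁ f) x _ = fderiv ℝ (iterPartial l₂ f) x _
    rw [(Filter.eventuallyEq_of_mem (hU.mem_nhds hx) ih).fderiv_eq]
  | swap i j l =>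
    intro x hx
    have hl := iterPartial_contDiffOn hU hf l
    have hs : IsSymmSndFDerivAt ℝ (iterPartial l f) x :=
      (hl.contDiffAt (hU.mem_nhds hx)).isSymmSndFDerivAt (by
        simp only [minSmoothness_of_isRCLikeNormedField]; exact WithTop.coe_le_coe.2 le_top)
    have hd : DifferentiableAt ℝ (fderiv ℝ (iterPartial l f)) x :=
      ((hl.fderiv_of_isOpen hU (m := ∞) (by simp)).contDiffAt
        (hU.mem_nhds hx)).differentiableAt (by simp)
    have key : ∀ a b : Fin m, iterPartial (a :: b :: l) f x =
        fderiv ℝ (fderiv ℝ (iterPartial l f)) x (Pi.single a 1) (Pi.single b 1) := by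
      intro a b
      change fderiv ℝ (fun y => fderiv ℝ (iterPartial l f) y (Pi.single b 1)) x (Pi.single a 1) = _
      rw [fderiv_clm_apply hd (differentiableAt_const _)]
      simp
    rw [key, key, hs.eq]
  | trans _ _ ih ih' => exact ih.trans ih'

/-- Equality of all partial derivatives up to order `k` at a point. -/
def AgreeToOrder (k : ℕ) (f g : (Fin m → ℝ) → V) (x : Fin m → ℝ) : Prop :=
  ∀ I : MultiIndex m k, multiDeriv I.1 f x = multiDeriv I.1 g x

theorem agreeToOrder_iff {f g : (Fin m → ℝ) → V} {U : Set (Fin m → ℝ)} (hU : IsOpen U)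
    (hf : ContDiffOn ℝ ∞ f U) (hg : ContDiffOn ℝ ∞ g U) {x : Fin m → ℝ} (hx : x ∈ U) (k : ℕ) :
    AgreeToOrder k f g x ↔ ∀ j ≤ k, iteratedFDeriv ℝ j f x = iteratedFDeriv ℝ j g x := by
  constructor
  · intro h j hj
    apply ContinuousMultilinearMap.toMultilinearMap_injective
    refine Module.Basis.ext_multilinear (fun _ => Pi.basisFun ℝ (Fin m)) fun s => ?_
    simp only [Pi.basisFun_apply, ContinuousMultilinearMap.coe_coe]
    have key : ∀ f : (Fin m → ℝ) → V, ContDiffOn ℝ ∞ f U →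
        iteratedFDeriv ℝ j f x (fun i => Pi.single (s i) (1 : ℝ)) =
          multiDeriv (fun i => (List.ofFn s).count i) f x := by
      intro f hf
      rw [multiDeriv, ← iterPartial_perm hU hf (perm_directions (List.ofFn s)) hx,
        iterPartial_eq hU hf _ hx]
      have : ∀ (n : ℕ) (hn : n = j) (t : Fin n → Fin m), (∀ i, t i = s (Fin.cast hn i)) →
          iteratedFDeriv ℝ j f x (fun i => Pi.single (s i) (1 : ℝ)) =
          iteratedFDeriv ℝ n f x (fun i => Pi.single (t i) (1 : ℝ)) := by
        rintro n rfl t ht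
        congr 1
        funext i
        rw [ht]; rfl
      exact this _ (by simp) _ (fun i => by simp [Fin.cast])
    rw [key f hf, key g hg]
    refine h ⟨fun i => (List.ofFn s).count i, ?_⟩
    rw [← length_directions (fun i => (List.ofFn s).count i), ← (perm_directions (List.ofFn s)).length_eq]
    simpa using hj
  · intro h I
    rw [multiDeriv, multiDeriv, iterPartial_eq hU hf _ hx, iterPartial_eq hU hg _ hx,
      h _ ((length_directions I.1).trans_le I.2)]

theorem iteratedFDeriv_comp_congr {X Y Z : Type*} [NormedAddCommGroup X] [NormedSpace ℝ X]
    [NormedAddCommGroup Y] [NormedSpace ℝ Y] [NormedAddCommGroup Z] [NormedSpace ℝ Z]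
    {g g' : Y → Z} {f f' : X → Y} {x : X} {k : ℕ}
    (hf : ContDiffAt ℝ ∞ f x) (hf' : ContDiffAt ℝ ∞ f' x)
    (hg : ContDiffAt ℝ ∞ g (f x)) (hg' : ContDiffAt ℝ ∞ g' (f x))
    (hff : ∀ j ≤ k, iteratedFDeriv ℝ j f x = iteratedFDeriv ℝ j f' x)
    (hgg : ∀ j ≤ k, iteratedFDeriv ℝ j g (f x) = iteratedFDeriv ℝ j g' (f x)) :
    ∀ j ≤ k, iteratedFDeriv ℝ j (g ∘ f) x = iteratedFDeriv ℝ j (g' ∘ f') x := by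
  have h0 : f x = f' x := by
    have := congrArg (fun q => q 0) (hff 0 (Nat.zero_le k))
    simpa using this
  intro j hj
  have hj' : (j : ℕ∞ω) ≤ ∞ := by exact_mod_cast le_top
  rw [iteratedFDeriv_comp hg hf hj', iteratedFDeriv_comp (h0 ▸ hg') hf' hj', ← h0]
  simp only [FormalMultilinearSeries.taylorComp]
  refine Finset.sum_congr rfl fun c _ => ?_
  simp only [FormalMultilinearSeries.compAlongOrderedFinpartition, ftaylorSeries]
  rw [hgg _ (c.length_le.trans hj)]
  have h1 : (fun i => iteratedFDeriv ℝ (c.partSize i) f x) =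
      fun i => iteratedFDeriv ℝ (c.partSize i) f' x :=
    funext fun i => hff _ ((c.partSize_le i).trans hj)
  rw [h1]

/-- Smooth dependence of iterated partial derivatives on parameters. -/
theorem iterPartial_param {Z : Type*} [NormedAddCommGroup Z] [NormedSpace ℝ Z]
    {G : Z → (Fin m → ℝ) → V} {W : Set (Z × (Fin m → ℝ))} (hW : IsOpen W)
    (hG : ContDiffOn ℝ ∞ (fun p => G p.1 p.2) W) (l : List (Fin m)) :
    ContDiffOn ℝ ∞ (fun p => iterPartial l (G p.1) p.2) W := by
  induction l with
  | nil => exact hG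
  | cons i l ih =>
    have h1 : ContDiffOn ℝ ∞ (fun p : Z × (Fin m → ℝ) =>
        fderiv ℝ (fun q : Z × (Fin m → ℝ) => iterPartial l (G q.1) q.2) p
          (0, Pi.single i 1)) W :=
      (ih.fderiv_of_isOpen hW (by simp)).clm_apply contDiffOn_const
    refine h1.congr fun p hp => ?_
    have hd : DifferentiableAt ℝ (fun q : Z × (Fin m → ℝ) => iterPartial l (G q.1) q.2) p :=
      (ih.contDiffAt (hW.mem_nhds hp)).differentiableAt (by simp)
    have h2 : HasFDerivAt (fun y : Fin m → ℝ => ((p.1, y) : Z × (Fin m → ℝ)))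
        (ContinuousLinearMap.inr ℝ Z (Fin m → ℝ)) p.2 := hasFDerivAt_prodMk_right p.1 p.2
    have h3 := HasFDerivAt.comp p.2 (hd.hasFDerivAt (x := (p.1, p.2))) h2
    change fderiv ℝ ((fun q : Z × (Fin m → ℝ) => iterPartial l (G q.1) q.2) ∘
      fun y : Fin m → ℝ => ((p.1, y) : Z × (Fin m → ℝ))) p.2 (Pi.single i 1) = _
    rw [h3.fderiv]
    simp

/-- The normalized monomial `(y - x)^I / I!`. -/
def taylorMonomial (x : Fin m → ℝ) (I : Fin m → ℕ) (y : Fin m → ℝ) : ℝ :=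
  ∏ i, (y i - x i) ^ I i / (I i).factorial

theorem contDiff_taylorMonomial (I : Fin m → ℕ) :
    ContDiff ℝ ∞ (fun p : (Fin m → ℝ) × (Fin m → ℝ) => taylorMonomial p.1 I p.2) := by
  unfold taylorMonomial
  fun_prop

theorem contDiff_taylorMonomial_right (x : Fin m → ℝ) (I : Fin m → ℕ) :
    ContDiff ℝ ∞ (fun y : Fin m → ℝ => taylorMonomial x I y) := by
  unfold taylorMonomial
  fun_prop

theorem partialDeriv_taylorMonomial_smul (x : Fin m → ℝ) (I : Fin m → ℕ) (a : V) (i : Fin m) :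
    partialDeriv i (fun y => taylorMonomial x I y • a) = fun y =>
      if 1 ≤ I i then taylorMonomial x (fun j => I j - if j = i then 1 else 0) y • a else 0 := by
  funext y
  have hd : DifferentiableAt ℝ (fun y => taylorMonomial x I y • a) y :=
    (((contDiff_taylorMonomial_right x I).smul contDiff_const).differentiable (by simp)) y
  have h1 : ∀ t : ℝ, taylorMonomial x I (y + t • Pi.single i (1 : ℝ)) =
      (y i + t - x i) ^ I i / (I i).factorial *
        ∏ j ∈ Finset.univ.erase i, (y j - x j) ^ I j / (I j).factorial := by
    intro t
    rw [taylorMonomial, ← Finset.mul_prod_erase _ _ (Finset.mem_univ i)]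
    congr 1
    · simp
    · refine Finset.prod_congr rfl fun j hj => ?_
      simp [Finset.ne_of_mem_erase hj]
  have h2 : HasDerivAt (fun t : ℝ => taylorMonomial x I (y + t • Pi.single i (1 : ℝ)) • a)
      (((I i : ℝ) * (y i - x i) ^ (I i - 1) / (I i).factorial *
        ∏ j ∈ Finset.univ.erase i, (y j - x j) ^ I j / (I j).factorial) • a) 0 := by
    simp only [h1]
    have h3 : HasDerivAt (fun t : ℝ => y i + t - x i) 1 0 :=
      ((hasDerivAt_id (0 : ℝ)).const_add (y i)).sub_const (x i)
    have h4 := ((h3.pow (I i)).div_const ((I i).factorial : ℝ)).mul_const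
      (∏ j ∈ Finset.univ.erase i, (y j - x j) ^ I j / (I j).factorial)
    simpa using h4.smul_const a
  change fderiv ℝ (fun y => taylorMonomial x I y • a) y (Pi.single i 1) = _
  rw [← hd.lineDeriv_eq_fderiv, lineDeriv, h2.deriv]
  split_ifs with h
  · congr 1
    conv_rhs => rw [taylorMonomial, ← Finset.mul_prod_erase _ _ (Finset.mem_univ i)]
    congr 1
    · obtain ⟨q, hq⟩ : ∃ q, I i = q + 1 := ⟨I i - 1, by omega⟩
      simp only [hq, if_true, Nat.add_sub_cancel, Nat.factorial_succ]
      push_cast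
      field_simp
    · refine Finset.prod_congr rfl fun j hj => ?_
      simp [Finset.ne_of_mem_erase hj]
  · have : I i = 0 := by omega
    simp [this]

theorem partialDeriv_zero (i : Fin m) : partialDeriv i (fun _ => (0 : V)) = fun _ => 0 := by
  funext y
  simp [partialDeriv]

theorem iterPartial_taylorMonomial_smul (x : Fin m → ℝ) (I : Fin m → ℕ) (a : V)
    (l : List (Fin m)) :
    iterPartial l (fun y => taylorMonomial x I y • a) = fun y =>
      if ∀ i, l.count i ≤ I i then taylorMonomial x (fun i => I i - l.count i) y • a else 0 := by
  induction l with
  | nil => simp [iterPartial]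
  | cons i l ih =>
    change partialDeriv i (iterPartial l _) = _
    rw [ih]
    by_cases h : ∀ i, l.count i ≤ I i
    · simp only [h, implies_true, if_true]
      rw [partialDeriv_taylorMonomial_smul]
      funext y
      have e : (1 ≤ I i - l.count i) ↔ ∀ j, (i :: l).count j ≤ I j := by
        constructor
        · intro h1 j
          rw [List.count_cons]
          by_cases hj : i = j
          · subst hj
            simp
            omega
          · simp [hj, h j]
        · intro h1
          have := h1 i
          rw [List.count_cons_self] at this
          omega
      have e' : (fun j => I j - l.count j - if j = i then 1 else 0) =
          fun j => I j - (i :: l).count j := by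
        funext j
        rw [List.count_cons]
        by_cases hj : i = j
        · subst hj
          simp
          omega
        · simp [hj, Ne.symm hj]
      simp only [e, e']
    · have h' : ¬ ∀ j, (i :: l).count j ≤ I j := fun h1 =>
        h fun j => (List.count_le_count_cons).trans (h1 j)
      simp only [h, h', if_false]
      exact partialDeriv_zero i

theorem taylorMonomial_self (x : Fin m → ℝ) (I : Fin m → ℕ) :
    taylorMonomial x I x = if I = 0 then 1 else 0 := by
  split_ifs with h
  · subst h
    simp [taylorMonomial]
  · obtain ⟨i, hi⟩ := Function.ne_iff.1 h
    refine Finset.prod_eq_zero (Finset.mem_univ i) ?_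
    have hi' : I i ≠ 0 := hi
    simp [hi']

theorem iterPartial_sum {ι : Type*} (s : Finset ι) (f : ι → (Fin m → ℝ) → V)
    (hf : ∀ a, ContDiff ℝ ∞ (f a)) (l : List (Fin m)) :
    iterPartial l (fun y => ∑ a ∈ s, f a y) = fun y => ∑ a ∈ s, iterPartial l (f a) y := by
  induction l with
  | nil => rfl
  | cons i l ih =>
    change partialDeriv i (iterPartial l _) = _
    rw [ih]
    funext y
    have hd : ∀ a ∈ s, DifferentiableAt ℝ (iterPartial l (f a)) y := fun a _ =>
      ((iterPartial_contDiffOn isOpen_univ (hf a).contDiffOn l).contDiffAt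
        Filter.univ_mem).differentiableAt (by simp)
    change fderiv ℝ (fun y => ∑ a ∈ s, iterPartial l (f a) y) y _ = _
    rw [fderiv_fun_sum hd]
    simp only [_root_.sum_apply]
    rfl

end Calculus

/-! ### Smooth fibre bundles, adapted charts and jets -/

/-- A smooth fibre bundle `π : E → M` with `dim M = m` and `dim E = m + n`: `π` is locally trivial
by diffeomorphisms over the base, with typical fibre an `n`-dimensional manifold. (Only the
differentiable structure of `ℝ^m` and of `ℝ^m × ℝ^n` is used, so the choice of norms on the model
spaces plays no role.) -/
class IsSmoothFiberBundle (m n : ℕ) {M : Type u} {E : Type v}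
    [TopologicalSpace M] [ChartedSpace (Fin m → ℝ) M]
    [TopologicalSpace E] [ChartedSpace ((Fin m → ℝ) × (Fin n → ℝ)) E] (π : E → M) : Prop where
  locallyTrivial : ∃ (F : Type v) (_ : TopologicalSpace F) (_ : ChartedSpace (Fin n → ℝ) F),
    IsManifold 𝓘(ℝ, Fin n → ℝ) ∞ F ∧
    ∀ x : M, ∃ t : Bundle.Trivialization F π, x ∈ t.baseSet ∧
      ContMDiffOn 𝓘(ℝ, (Fin m → ℝ) × (Fin n → ℝ))
        (𝓘(ℝ, Fin m → ℝ).prod 𝓘(ℝ, Fin n → ℝ)) ∞ t t.source ∧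
      ContMDiffOn (𝓘(ℝ, Fin m → ℝ).prod 𝓘(ℝ, Fin n → ℝ))
        𝓘(ℝ, (Fin m → ℝ) × (Fin n → ℝ)) ∞ t.toOpenPartialHomeomorph.symm t.target

/-- Coordinates `(x^i, u^α)` of `E` adapted to `π`, over coordinates `(x^i)` of `M`. -/
structure AdaptedChart (m n : ℕ) {M : Type u} {E : Type v}
    [TopologicalSpace M] [ChartedSpace (Fin m → ℝ) M]
    [TopologicalSpace E] [ChartedSpace ((Fin m → ℝ) × (Fin n → ℝ)) E] (π : E → M) where
  /-- the coordinates `x^i` on an open subset of `M` -/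
  base : OpenPartialHomeomorph M (Fin m → ℝ)
  /-- the coordinates `(x^i, u^α)` on an open subset of `E` -/
  total : OpenPartialHomeomorph E ((Fin m → ℝ) × (Fin n → ℝ))
  contMDiffOn_base : ContMDiffOn 𝓘(ℝ, Fin m → ℝ) 𝓘(ℝ, Fin m → ℝ) ∞ base base.source
  contMDiffOn_base_symm :
    ContMDiffOn 𝓘(ℝ, Fin m → ℝ) 𝓘(ℝ, Fin m → ℝ) ∞ base.symm base.target
  contMDiffOn_total : ContMDiffOn 𝓘(ℝ, (Fin m → ℝ) × (Fin n → ℝ))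
    𝓘(ℝ, (Fin m → ℝ) × (Fin n → ℝ)) ∞ total total.source
  contMDiffOn_total_symm : ContMDiffOn 𝓘(ℝ, (Fin m → ℝ) × (Fin n → ℝ))
    𝓘(ℝ, (Fin m → ℝ) × (Fin n → ℝ)) ∞ total.symm total.target
  proj_mem : ∀ e ∈ total.source, π e ∈ base.source
  total_fst : ∀ e ∈ total.source, (total e).1 = base (π e)

/-- A smooth section of `π` over an open subset `dom` of `M`, together with a point of `dom`. -/
structure LocalSection (m n : ℕ) {M : Type u} {E : Type v}
    [TopologicalSpace M] [ChartedSpace (Fin m → ℝ) M]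
    [TopologicalSpace E] [ChartedSpace ((Fin m → ℝ) × (Fin n → ℝ)) E] (π : E → M) where
  /-- the point of `M` at which the jet is taken -/
  pt : M
  /-- the section; its values outside `dom` are irrelevant -/
  toFun : M → E
  /-- the domain of the section -/
  dom : Set M
  isOpen_dom : IsOpen dom
  pt_mem : pt ∈ dom
  contMDiffOn_toFun :
    ContMDiffOn 𝓘(ℝ, Fin m → ℝ) 𝓘(ℝ, (Fin m → ℝ) × (Fin n → ℝ)) ∞ toFun dom
  proj_toFun : ∀ x ∈ dom, π (toFun x) = x

/-- The model space of `J^kπ`: coordinates `(x^i, u^α_I)`, where `I` runs over the multi-indices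
with `0 ≤ |I| ≤ k` (and `u^α_0 = u^α`). -/
abbrev JetModel (m n k : ℕ) : Type := (Fin m → ℝ) × (MultiIndex m k → Fin n → ℝ)

/-- The multi-index `0`. -/
def MultiIndex.zero (m k : ℕ) : MultiIndex m k := ⟨0, by simp⟩

section Jets

variable {m n : ℕ} {M : Type u} {E : Type v}
  [TopologicalSpace M] [ChartedSpace (Fin m → ℝ) M]
  [TopologicalSpace E] [ChartedSpace ((Fin m → ℝ) × (Fin n → ℝ)) E] {π : E → M}

/-- The components `u^α ∘ φ` of a local section `φ` as functions of the coordinates `x^i`. -/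
def AdaptedChart.localRep (c : AdaptedChart m n π) (s : LocalSection m n π) :
    (Fin m → ℝ) → (Fin n → ℝ) :=
  fun y => (c.total (s.toFun (c.base.symm y))).2

theorem LocalSection.proj_pt (s : LocalSection m n π) : π (s.toFun s.pt) = s.pt :=
  s.proj_toFun _ s.pt_mem

theorem AdaptedChart.pt_mem (c : AdaptedChart m n π) (s : LocalSection m n π)
    (h : s.toFun s.pt ∈ c.total.source) : s.pt ∈ c.base.source := by
  simpa [s.proj_pt] using c.proj_mem _ h

theorem AdaptedChart.exists_localRep (c : AdaptedChart m n π) (s : LocalSection m n π)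
    (h : s.toFun s.pt ∈ c.total.source) :
    ∃ U : Set (Fin m → ℝ), IsOpen U ∧ c.base s.pt ∈ U ∧ U ⊆ c.base.target ∧
      ContDiffOn ℝ ∞ (c.localRep s) U ∧
      ∀ y ∈ U, s.toFun (c.base.symm y) ∈ c.total.source ∧
        c.total (s.toFun (c.base.symm y)) = (y, c.localRep s y) := by
  have hO : IsOpen (s.dom ∩ s.toFun ⁻¹' c.total.source) :=
    s.contMDiffOn_toFun.continuousOn.isOpen_inter_preimage s.isOpen_dom c.total.open_source
  refine ⟨c.base.target ∩ c.base.symm ⁻¹' (s.dom ∩ s.toFun ⁻¹' c.total.source),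
    c.base.isOpen_inter_preimage_symm hO, ?_, inter_subset_left, ?_, ?_⟩
  · have hp := c.pt_mem s h
    refine ⟨c.base.map_source hp, ?_⟩
    simp only [mem_preimage, c.base.left_inv hp]
    exact ⟨s.pt_mem, h⟩
  · have h1 : ContMDiffOn 𝓘(ℝ, Fin m → ℝ) 𝓘(ℝ, (Fin m → ℝ) × (Fin n → ℝ)) ∞
        (fun y => c.total (s.toFun (c.base.symm y)))
        (c.base.target ∩ c.base.symm ⁻¹' (s.dom ∩ s.toFun ⁻¹' c.total.source)) :=
      c.contMDiffOn_total.comp (s.contMDiffOn_toFun.comp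
        (c.contMDiffOn_base_symm.mono inter_subset_left) (fun y hy => hy.2.1))
        (fun y hy => hy.2.2)
    exact (contMDiffOn_iff_contDiffOn.1 h1).snd
  · rintro y ⟨hy, hy1, hy2⟩
    refine ⟨hy2, Prod.ext ?_ rfl⟩
    rw [c.total_fst _ hy2, s.proj_toFun _ hy1, c.base.right_inv hy]

theorem AdaptedChart.localRep_transition (c c' : AdaptedChart m n π) (s : LocalSection m n π)
    (h : s.toFun s.pt ∈ c.total.source) (h' : s.toFun s.pt ∈ c'.total.source) :
    c'.localRep s =ᶠ[𝓝 (c'.base s.pt)] fun y =>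
      (c'.total (c.total.symm (c.base (c'.base.symm y),
        c.localRep s (c.base (c'.base.symm y))))).2 := by
  obtain ⟨U, hU, hxU, -, -, hUs⟩ := c.exists_localRep s h
  have hp := c.pt_mem s h
  have hp' := c'.pt_mem s h'
  have hcont : ContinuousAt (fun y => c.base (c'.base.symm y)) (c'.base s.pt) := by
    refine ContinuousAt.comp ?_ (c'.base.continuousAt_symm (c'.base.map_source hp'))
    rw [c'.base.left_inv hp']
    exact c.base.continuousAt hp
  have hcs : ContinuousAt c'.base.symm (c'.base s.pt) :=
    c'.base.continuousAt_symm (c'.base.map_source hp')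
  filter_upwards [hcont.preimage_mem_nhds (hU.mem_nhds (by simpa [c'.base.left_inv hp'] using hxU)),
    hcs.preimage_mem_nhds (c.base.open_source.mem_nhds (by simpa [c'.base.left_inv hp'] using hp))]
    with y hy hy2
  have h3 := hUs _ hy
  rw [c.base.left_inv hy2] at h3
  rw [← h3.2, c.total.left_inv h3.1]
  rfl

theorem iteratedFDeriv_prodMk_congr {X Y Z : Type*} [NormedAddCommGroup X] [NormedSpace ℝ X]
    [NormedAddCommGroup Y] [NormedSpace ℝ Y] [NormedAddCommGroup Z] [NormedSpace ℝ Z]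
    {f f' : X → Y} {g : X → Z} {x : X} {k : ℕ}
    (hf : ContDiffAt ℝ ∞ f x) (hf' : ContDiffAt ℝ ∞ f' x) (hg : ContDiffAt ℝ ∞ g x)
    (hff : ∀ j ≤ k, iteratedFDeriv ℝ j f x = iteratedFDeriv ℝ j f' x) :
    ∀ j ≤ k, iteratedFDeriv ℝ j (fun y => (g y, f y)) x =
      iteratedFDeriv ℝ j (fun y => (g y, f' y)) x := by
  intro j hj
  have hj' : (j : ℕ∞ω) ≤ ∞ := by exact_mod_cast le_top
  rw [iteratedFDeriv_prodMk (hg.of_le hj') (hf.of_le hj') le_rfl,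
    iteratedFDeriv_prodMk (hg.of_le hj') (hf'.of_le hj') le_rfl, hff j hj]

theorem AdaptedChart.agree_transition (c c' : AdaptedChart m n π) (s t : LocalSection m n π)
    (hpt : s.pt = t.pt) (hval : s.toFun s.pt = t.toFun t.pt)
    (h : s.toFun s.pt ∈ c.total.source) (h' : s.toFun s.pt ∈ c'.total.source) {k : ℕ}
    (H : AgreeToOrder k (c.localRep s) (c.localRep t) (c.base s.pt)) :
    AgreeToOrder k (c'.localRep s) (c'.localRep t) (c'.base s.pt) := by
  have ht : t.toFun t.pt ∈ c.total.source := hval ▸ h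
  have ht' : t.toFun t.pt ∈ c'.total.source := hval ▸ h'
  obtain ⟨U, hU, hxU, hUt, hUd, hUs⟩ := c.exists_localRep s h
  obtain ⟨V, hV, hxV, hVt, hVd, hVs⟩ := c.exists_localRep t ht
  obtain ⟨U', hU', hxU', hUt', hUd', hUs'⟩ := c'.exists_localRep s h'
  obtain ⟨V', hV', hxV', hVt', hVd', hVs'⟩ := c'.exists_localRep t ht'
  rw [← hpt] at hxV hxV'
  rw [agreeToOrder_iff (hU.inter hV) (hUd.mono inter_subset_left) (hVd.mono inter_subset_right)
    ⟨hxU, hxV⟩] at H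
  rw [agreeToOrder_iff (hU'.inter hV') (hUd'.mono inter_subset_left)
    (hVd'.mono inter_subset_right) ⟨hxU', hxV'⟩]
  have hp := c.pt_mem s h
  have hp' := c'.pt_mem s h'
  have e1 := c.localRep_transition c' s h h'
  have e2 := c.localRep_transition c' t ht ht'
  rw [← hpt] at e2
  -- the change of coordinates on the base
  have hψ0 : (c.base ∘ c'.base.symm) (c'.base s.pt) = c.base s.pt := by
    simp [c'.base.left_inv hp']
  have hψ : ContDiffAt ℝ ∞ (c.base ∘ c'.base.symm) (c'.base s.pt) := by
    rw [← contMDiffAt_iff_contDiffAt]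
    refine ContMDiffAt.comp _ ?_ (c'.contMDiffOn_base_symm.contMDiffAt
      (c'.base.open_target.mem_nhds (c'.base.map_source hp')))
    rw [c'.base.left_inv hp']
    exact c.contMDiffOn_base.contMDiffAt (c.base.open_source.mem_nhds hp)
  have hs1 : c.total.symm (c.base s.pt, c.localRep s (c.base s.pt)) = s.toFun s.pt := by
    have := (hUs _ hxU)
    rw [c.base.left_inv hp] at this
    rw [← this.2, c.total.left_inv h]
  have hsT : (c.base s.pt, c.localRep s (c.base s.pt)) ∈ c.total.target := by
    have := (hUs _ hxU)
    rw [c.base.left_inv hp] at this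
    rw [← this.2]
    exact c.total.map_source h
  have hΨ : ContDiffAt ℝ ∞ (fun q => (c'.total (c.total.symm q)).2)
      (c.base s.pt, c.localRep s (c.base s.pt)) := by
    refine ContDiffAt.snd ?_
    rw [← contMDiffAt_iff_contDiffAt]
    refine ContMDiffAt.comp (g := c'.total) _ ?_ (c.contMDiffOn_total_symm.contMDiffAt
      (c.total.open_target.mem_nhds hsT))
    rw [hs1]
    exact c'.contMDiffOn_total.contMDiffAt (c'.total.open_source.mem_nhds h')
  have hrs : ContDiffAt ℝ ∞ (c.localRep s) (c.base s.pt) := hUd.contDiffAt (hU.mem_nhds hxU)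
  have hrt : ContDiffAt ℝ ∞ (c.localRep t) (c.base s.pt) := hVd.contDiffAt (hV.mem_nhds hxV)
  have hr0 : c.localRep s (c.base s.pt) = c.localRep t (c.base s.pt) := by
    have := congrArg (fun q => q 0) (H 0 (Nat.zero_le k))
    simpa using this
  have step1 := iteratedFDeriv_prodMk_congr (g := fun y => y) hrs hrt contDiffAt_id H
  have step2 := iteratedFDeriv_comp_congr (k := k)
    (g := fun q => (c'.total (c.total.symm q)).2) (g' := fun q => (c'.total (c.total.symm q)).2)
    (f := fun y => (y, c.localRep s y)) (f' := fun y => (y, c.localRep t y))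
    (contDiffAt_id.prodMk hrs) (contDiffAt_id.prodMk hrt) hΨ hΨ step1 (fun _ _ => rfl)
  have hA : ContDiffAt ℝ ∞ ((fun q => (c'.total (c.total.symm q)).2) ∘
      fun y => (y, c.localRep s y)) (c.base s.pt) :=
    ContDiffAt.comp (c.base s.pt) hΨ (contDiffAt_id.prodMk hrs)
  have hB : ContDiffAt ℝ ∞ ((fun q => (c'.total (c.total.symm q)).2) ∘
      fun y => (y, c.localRep t y)) (c.base s.pt) :=
    ContDiffAt.comp (c.base s.pt) (hr0 ▸ hΨ) (contDiffAt_id.prodMk hrt)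
  rw [← hψ0] at hA hB step2
  have step3 := iteratedFDeriv_comp_congr hψ hψ hA hB (fun _ _ => rfl) step2
  intro j hj
  rw [(e1.iteratedFDeriv ℝ j).eq_of_nhds, (e2.iteratedFDeriv ℝ j).eq_of_nhds]
  exact step3 j hj

variable (m n π) in
/-- Two local sections have the same `k`-jet at a point when they have there the same value and, in
adapted coordinates, the same partial derivatives `∂^{|I|}u^α/∂x^I` for `|I| ≤ k`. -/
def jetSetoid (k : ℕ) : Setoid (LocalSection m n π) where
  r s t := s.pt = t.pt ∧ s.toFun s.pt = t.toFun t.pt ∧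
    ∀ c : AdaptedChart m n π, s.toFun s.pt ∈ c.total.source →
      AgreeToOrder k (c.localRep s) (c.localRep t) (c.base s.pt)
  iseqv :=
    { refl := fun _ => ⟨rfl, rfl, fun _ _ _ => rfl⟩
      symm := fun h => ⟨h.1.symm, h.2.1.symm, fun c hc I => by
        rw [← h.1]; exact (h.2.2 c (h.2.1 ▸ hc) I).symm⟩
      trans := fun h h' => ⟨h.1.trans h'.1, h.2.1.trans h'.2.1, fun c hc I =>
        (h.2.2 c hc I).trans (by rw [h.1]; exact h'.2.2 c (h.2.1 ▸ hc) I)⟩ }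

variable (m n π) in
/-- The `k`-jet manifold `J^kπ`: the `k`-jets `j^k_xφ` of local sections `φ` of `π`. -/
def Jet (k : ℕ) : Type (max u v) := Quotient (jetSetoid m n π k)

/-- The `k`-jet of a local section at its marked point. -/
def LocalSection.jet (s : LocalSection m n π) (k : ℕ) : Jet m n π k :=
  Quotient.mk (jetSetoid m n π k) s

/-- The projection `π^k : J^kπ → E`. -/
def Jet.toTotal {k : ℕ} : Jet m n π k → E :=
  Quotient.lift (fun s : LocalSection m n π => s.toFun s.pt) fun _ _ h => h.2.1

variable (m n π) in
/-- The projection `π^k_s : J^kπ → J^sπ`. -/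
def jetProj {s k : ℕ} (h : s ≤ k) : Jet m n π k → Jet m n π s :=
  Quotient.map' (s₁ := jetSetoid m n π k) (s₂ := jetSetoid m n π s) id
    fun _ _ hab => ⟨hab.1, hab.2.1, fun c hc I => hab.2.2 c hc ⟨I.1, I.2.trans h⟩⟩

/-- The natural coordinates of a `k`-jet: `u^α_I(j^k_xφ) = ∂^{|I|}(u^α ∘ φ)/∂x^I (x)`. -/
def AdaptedChart.jetCoord (c : AdaptedChart m n π) (k : ℕ) (j : Jet m n π k) : JetModel m n k :=
  (c.base (Quotient.out j).pt,
    fun I => multiDeriv I.1 (c.localRep (Quotient.out j)) (c.base (Quotient.out j).pt))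

theorem AdaptedChart.jetCoord_jet (c : AdaptedChart m n π) (k : ℕ) (s : LocalSection m n π)
    (h : s.toFun s.pt ∈ c.total.source) : c.jetCoord k (s.jet k) =
      (c.base s.pt, fun I => multiDeriv I.1 (c.localRep s) (c.base s.pt)) := by
  have h1 : (jetSetoid m n π k).r (Quotient.out (s.jet k)) s := Quotient.mk_out s
  have h2 := h1.2.2 c (h1.2.1 ▸ h)
  refine Prod.ext (congrArg c.base h1.1) (funext fun I => ?_)
  exact (h2 I).trans (by rw [h1.1])

/-- The polynomial map with prescribed partial derivatives at `z.1`. -/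
def taylorPoly {k : ℕ} (z : JetModel m n k) (y : Fin m → ℝ) : Fin n → ℝ :=
  ∑ I : MultiIndex m k, taylorMonomial z.1 I.1 y • z.2 I

theorem contDiff_taylorPoly {k : ℕ} :
    ContDiff ℝ ∞ (fun p : JetModel m n k × (Fin m → ℝ) => taylorPoly p.1 p.2) := by
  unfold taylorPoly
  refine ContDiff.sum fun I _ => ?_
  have h1 : ContDiff ℝ ∞ (fun p : JetModel m n k × (Fin m → ℝ) =>
      taylorMonomial p.1.1 I.1 p.2) :=
    (contDiff_taylorMonomial I.1).comp (contDiff_fst.fst.prodMk contDiff_snd)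
  have h2 : ContDiff ℝ ∞ (fun p : JetModel m n k × (Fin m → ℝ) => p.1.2 I) :=
    (contDiff_apply ℝ (Fin n → ℝ) I).comp contDiff_fst.snd
  exact h1.smul h2

theorem contDiff_taylorPoly_right {k : ℕ} (z : JetModel m n k) : ContDiff ℝ ∞ (taylorPoly z) :=
  (contDiff_taylorPoly (m := m) (n := n) (k := k)).comp
    (f := fun y : Fin m → ℝ => (z, y)) (contDiff_const.prodMk contDiff_id)

theorem multiDeriv_taylorPoly {k : ℕ} (z : JetModel m n k) (J : MultiIndex m k) :
    multiDeriv J.1 (taylorPoly z) z.1 = z.2 J := by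
  have h := iterPartial_sum Finset.univ
    (fun (I : MultiIndex m k) y => taylorMonomial z.1 I.1 y • z.2 I)
    (fun I => (contDiff_taylorMonomial_right z.1 I.1).smul contDiff_const) (directions J.1)
  have h' : multiDeriv J.1 (taylorPoly z) = _ := h
  rw [h']
  dsimp only
  rw [Finset.sum_eq_single J]
  · rw [iterPartial_taylorMonomial_smul]
    simp [count_directions, taylorMonomial_self, Pi.zero_def]
  · intro I _ hI
    rw [iterPartial_taylorMonomial_smul]
    simp only [count_directions, taylorMonomial_self]
    split_ifs with h1 h2
    · exact absurd (Subtype.ext (funext fun i => by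
        have := congrFun h2 i
        have := h1 i
        simp at *
        omega)) hI
    · simp
    · rfl
  · simp

theorem taylorPoly_self {k : ℕ} (z : JetModel m n k) :
    taylorPoly z z.1 = z.2 (MultiIndex.zero m k) := by
  rw [← multiDeriv_taylorPoly z (MultiIndex.zero m k)]
  have : directions (MultiIndex.zero m k).1 = [] := by
    rw [← List.length_eq_zero_iff, length_directions]
    simp [MultiIndex.zero]
  rw [multiDeriv, this]
  rfl

/-- The local section which is polynomial in adapted coordinates, with prescribed natural
coordinates of its `k`-jet. -/
def AdaptedChart.polySection (c : AdaptedChart m n π) {k : ℕ} (z : JetModel m n k)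
    (h : (z.1, z.2 (MultiIndex.zero m k)) ∈ c.total.target) : LocalSection m n π where
  pt := c.base.symm z.1
  toFun x := c.total.symm (c.base x, taylorPoly z (c.base x))
  dom := c.base.source ∩ c.base ⁻¹' {y | (y, taylorPoly z y) ∈ c.total.target}
  isOpen_dom := by
    refine c.base.isOpen_inter_preimage ?_
    exact c.total.open_target.preimage
      (continuous_id.prodMk (contDiff_taylorPoly_right z).continuous)
  pt_mem := by
    have h1 := c.proj_mem _ (c.total.map_target h)
    have h2 := c.total_fst _ (c.total.map_target h)
    rw [c.total.right_inv h] at h2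
    have hz : z.1 ∈ c.base.target := by
      have := c.base.map_source h1
      rwa [← h2] at this
    refine ⟨c.base.map_target hz, ?_⟩
    simp only [mem_preimage, mem_ofPred_eq, c.base.right_inv hz, taylorPoly_self]
    exact h
  contMDiffOn_toFun := by
    refine c.contMDiffOn_total_symm.comp (t := c.total.target) ?_ (fun x hx => hx.2)
    have h1 : ContMDiff 𝓘(ℝ, Fin m → ℝ) 𝓘(ℝ, (Fin m → ℝ) × (Fin n → ℝ)) ∞
        (fun y => (y, taylorPoly z y)) :=
      (contDiff_id.prodMk (contDiff_taylorPoly_right z)).contMDiff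
    exact h1.comp_contMDiffOn (c.contMDiffOn_base.mono inter_subset_left)
  proj_toFun := by
    rintro x ⟨hx, hx2⟩
    have h1 := c.proj_mem _ (c.total.map_target hx2)
    have h2 := c.total_fst _ (c.total.map_target hx2)
    rw [c.total.right_inv hx2] at h2
    exact (c.base.injOn hx h1 h2).symm

theorem AdaptedChart.fst_mem_target (c : AdaptedChart m n π) {q : (Fin m → ℝ) × (Fin n → ℝ)}
    (h : q ∈ c.total.target) : q.1 ∈ c.base.target := by
  have h1 := c.proj_mem _ (c.total.map_target h)
  have h2 := c.total_fst _ (c.total.map_target h)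
  rw [c.total.right_inv h] at h2
  rw [h2]
  exact c.base.map_source h1

theorem AdaptedChart.polySection_value (c : AdaptedChart m n π) {k : ℕ} (z : JetModel m n k)
    (h : (z.1, z.2 (MultiIndex.zero m k)) ∈ c.total.target) :
    (c.polySection z h).toFun (c.polySection z h).pt =
      c.total.symm (z.1, z.2 (MultiIndex.zero m k)) := by
  have hz := c.fst_mem_target h
  simp only [AdaptedChart.polySection, c.base.right_inv hz, taylorPoly_self]

theorem AdaptedChart.localRep_polySection (c : AdaptedChart m n π) {k : ℕ} (z : JetModel m n k)
    (h : (z.1, z.2 (MultiIndex.zero m k)) ∈ c.total.target) :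
    c.localRep (c.polySection z h) =ᶠ[𝓝 z.1] taylorPoly z := by
  have h1 : ContinuousAt (fun y => (y, taylorPoly z y)) z.1 :=
    (continuous_id.prodMk (contDiff_taylorPoly_right z).continuous).continuousAt
  filter_upwards [c.base.open_target.mem_nhds (c.fst_mem_target h),
    h1.preimage_mem_nhds (c.total.open_target.mem_nhds (by simpa [taylorPoly_self] using h))]
    with y hy hy2
  simp only [AdaptedChart.localRep, AdaptedChart.polySection, c.base.right_inv hy]
  rw [c.total.right_inv hy2]

theorem AdaptedChart.jetCoord_polySection (c : AdaptedChart m n π) {k : ℕ} (z : JetModel m n k)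
    (h : (z.1, z.2 (MultiIndex.zero m k)) ∈ c.total.target) :
    c.jetCoord k ((c.polySection z h).jet k) = z := by
  have hz := c.fst_mem_target h
  have hb : c.base (c.polySection z h).pt = z.1 := c.base.right_inv hz
  rw [c.jetCoord_jet k _ (by rw [c.polySection_value]; exact c.total.map_target h), hb]
  refine Prod.ext rfl (funext fun I => ?_)
  rw [← multiDeriv_taylorPoly z I]
  exact (iterPartial_eventuallyEq (c.localRep_polySection z h) _).eq_of_nhds

theorem exists_adaptedChart [IsManifold 𝓘(ℝ, Fin m → ℝ) ∞ M] [IsSmoothFiberBundle m n π]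
    (e : E) : ∃ c : AdaptedChart m n π, e ∈ c.total.source := by
  obtain ⟨F, _, _, _, hF⟩ := IsSmoothFiberBundle.locallyTrivial (m := m) (n := n) (π := π)
  obtain ⟨t, ht, ht1, ht2⟩ := hF (π e)
  let φ := chartAt (Fin m → ℝ) (π e)
  have het : e ∈ t.source := by rw [t.source_eq]; exact ht
  let ψ := chartAt (Fin n → ℝ) (t e).2
  have hte : (t e).1 = π e := t.proj_toFun e het
  have h1 : ContMDiffOn (𝓘(ℝ, Fin m → ℝ).prod 𝓘(ℝ, Fin n → ℝ))
      𝓘(ℝ, (Fin m → ℝ) × (Fin n → ℝ)) ∞ (fun q : M × F => (φ q.1, ψ q.2))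
      (φ.source ×ˢ ψ.source) :=
    ((contMDiffOn_chart (I := 𝓘(ℝ, Fin m → ℝ)) (n := ∞)).comp contMDiffOn_fst
      (fun q hq => hq.1)).prodMk_space
      ((contMDiffOn_chart (I := 𝓘(ℝ, Fin n → ℝ)) (n := ∞)).comp contMDiffOn_snd
      (fun q hq => hq.2))
  have h2 : ContMDiffOn 𝓘(ℝ, (Fin m → ℝ) × (Fin n → ℝ))
      (𝓘(ℝ, Fin m → ℝ).prod 𝓘(ℝ, Fin n → ℝ)) ∞
      (fun q : (Fin m → ℝ) × (Fin n → ℝ) => (φ.symm q.1, ψ.symm q.2))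
      (φ.target ×ˢ ψ.target) :=
    ((contMDiffOn_chart_symm (I := 𝓘(ℝ, Fin m → ℝ)) (n := ∞)).comp
      contDiff_fst.contMDiff.contMDiffOn (fun q hq => hq.1)).prodMk
      ((contMDiffOn_chart_symm (I := 𝓘(ℝ, Fin n → ℝ)) (n := ∞)).comp
      contDiff_snd.contMDiff.contMDiffOn (fun q hq => hq.2))
  refine ⟨⟨φ, t.toOpenPartialHomeomorph.trans (φ.prod ψ), contMDiffOn_chart,
    contMDiffOn_chart_symm, ?_, ?_, ?_, ?_⟩, ?_⟩
  · exact h1.comp (ht1.mono inter_subset_left) (fun a ha => ha.2)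
  · exact ht2.comp (h2.mono inter_subset_left) (fun a ha => ha.2)
  · rintro a ⟨ha1, ha2⟩
    have := ha2.1
    change (t a).1 ∈ φ.source at this
    rwa [show (t a).1 = π a from t.proj_toFun a ha1] at this
  · rintro a ⟨ha1, ha2⟩
    change φ (t a).1 = φ (π a)
    rw [show (t a).1 = π a from t.proj_toFun a ha1]
  · refine ⟨het, ?_, ?_⟩
    · change (t e).1 ∈ φ.source
      rw [hte]
      exact mem_chart_source _ _
    · exact mem_chart_source _ _

theorem exists_jetChart_aux [IsManifold 𝓘(ℝ, Fin m → ℝ) ∞ M] [IsSmoothFiberBundle m n π]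
    (c : AdaptedChart m n π) (k : ℕ) : Nonempty (Jet m n π k) := by
  obtain ⟨c', hc'⟩ := exists_adaptedChart (m := m) (n := n) (π := π) (c.total.symm 0)
  refine ⟨(c'.polySection (k := 0) ((c'.total (c.total.symm 0)).1,
    fun _ => (c'.total (c.total.symm 0)).2) (c'.total.map_source hc')).jet k⟩

theorem Jet.exists_jet {k : ℕ} (j : Jet m n π k) : ∃ s : LocalSection m n π, s.jet k = j :=
  Quotient.exists_rep j

theorem AdaptedChart.jetCoord_zero (c : AdaptedChart m n π) (k : ℕ) (s : LocalSection m n π)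
    (hs : s.toFun s.pt ∈ c.total.source) :
    ((c.jetCoord k (s.jet k)).1, (c.jetCoord k (s.jet k)).2 (MultiIndex.zero m k)) =
      c.total (s.toFun s.pt) := by
  obtain ⟨U, -, hx, -, -, h2⟩ := c.exists_localRep s hs
  have h3 := h2 _ hx
  rw [c.base.left_inv (c.pt_mem s hs)] at h3
  have hd : directions (MultiIndex.zero m k).1 = [] := by
    rw [← List.length_eq_zero_iff, length_directions]
    simp [MultiIndex.zero]
  rw [c.jetCoord_jet k s hs, h3.2]
  simp only [multiDeriv, hd, iterPartial, List.foldr_nil]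

open Classical in
/-- The jet with given natural coordinates. -/
def AdaptedChart.jetOfCoord [IsManifold 𝓘(ℝ, Fin m → ℝ) ∞ M] [IsSmoothFiberBundle m n π]
    (c : AdaptedChart m n π) (k : ℕ) (z : JetModel m n k) : Jet m n π k :=
  if h : (z.1, z.2 (MultiIndex.zero m k)) ∈ c.total.target then
    (c.polySection z h).jet k else (exists_jetChart_aux c k).some

theorem AdaptedChart.jetOfCoord_eq [IsManifold 𝓘(ℝ, Fin m → ℝ) ∞ M]
    [IsSmoothFiberBundle m n π] (c : AdaptedChart m n π) {k : ℕ} (z : JetModel m n k)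
    (h : (z.1, z.2 (MultiIndex.zero m k)) ∈ c.total.target) :
    c.jetOfCoord k z = (c.polySection z h).jet k := dif_pos h

theorem AdaptedChart.jetOfCoord_jetCoord [IsManifold 𝓘(ℝ, Fin m → ℝ) ∞ M]
    [IsSmoothFiberBundle m n π] (c : AdaptedChart m n π) (k : ℕ) (s : LocalSection m n π)
    (hs : s.toFun s.pt ∈ c.total.source) :
    c.jetOfCoord k (c.jetCoord k (s.jet k)) = s.jet k := by
  have h1 := c.jetCoord_jet k s hs
  have h4 := c.jetCoord_zero k s hs
  have hz : ((c.jetCoord k (s.jet k)).1, (c.jetCoord k (s.jet k)).2 (MultiIndex.zero m k)) ∈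
      c.total.target := by
    rw [h4]
    exact c.total.map_source hs
  rw [c.jetOfCoord_eq _ hz]
  have hp : (c.polySection (c.jetCoord k (s.jet k)) hz).pt = s.pt := by
    change c.base.symm _ = _
    rw [h1, c.base.left_inv (c.pt_mem s hs)]
  have hv : (c.polySection (c.jetCoord k (s.jet k)) hz).toFun
      (c.polySection (c.jetCoord k (s.jet k)) hz).pt = s.toFun s.pt := by
    rw [c.polySection_value, h4, c.total.left_inv hs]
  have h5 := c.jetCoord_polySection _ hz
  rw [c.jetCoord_jet k _ (hv ▸ hs)] at h5
  refine Quotient.sound ⟨hp, hv, fun c' hc' => ?_⟩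
  refine c.agree_transition c' _ _ hp hv (hv ▸ hs) hc' fun I => ?_
  have h6 := congrFun (congrArg Prod.snd (h5.trans h1)) I
  rw [hp] at h6 ⊢
  exact h6

/-- The natural chart of `J^kπ` induced by adapted coordinates of `E` (as a bijection between
subsets). -/
def AdaptedChart.jetPartialEquiv [IsManifold 𝓘(ℝ, Fin m → ℝ) ∞ M] [IsSmoothFiberBundle m n π]
    (c : AdaptedChart m n π) (k : ℕ) : PartialEquiv (Jet m n π k) (JetModel m n k) where
  toFun := c.jetCoord k
  invFun := c.jetOfCoord k
  source := {j | j.toTotal ∈ c.total.source}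
  target := {z | (z.1, z.2 (MultiIndex.zero m k)) ∈ c.total.target}
  map_source' := by
    intro j hj
    obtain ⟨s, rfl⟩ := j.exists_jet
    have hs : s.toFun s.pt ∈ c.total.source := hj
    change ((c.jetCoord k (s.jet k)).1, (c.jetCoord k (s.jet k)).2 (MultiIndex.zero m k)) ∈ c.total.target
    rw [c.jetCoord_zero k s hs]
    exact c.total.map_source hs
  map_target' := by
    intro z hz
    rw [c.jetOfCoord_eq z hz]
    change (c.polySection z hz).toFun (c.polySection z hz).pt ∈ c.total.source
    rw [c.polySection_value]
    exact c.total.map_target hz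
  left_inv' := by
    intro j hj
    obtain ⟨s, rfl⟩ := j.exists_jet
    exact c.jetOfCoord_jetCoord k s hj
  right_inv' := by
    intro z hz
    rw [c.jetOfCoord_eq z hz]
    exact c.jetCoord_polySection z hz

theorem AdaptedChart.contDiffOn_totalTransition (c c' : AdaptedChart m n π) :
    ContDiffOn ℝ ∞ (fun q => c'.total (c.total.symm q))
      (c.total.symm.trans c'.total).source := by
  rw [← contMDiffOn_iff_contDiffOn]
  exact c'.contMDiffOn_total.comp (c.contMDiffOn_total_symm.mono inter_subset_left)
    (fun q hq => hq.2)

theorem AdaptedChart.contDiffOn_baseTransition (c c' : AdaptedChart m n π) :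
    ContDiffOn ℝ ∞ (fun q => c'.base (c.base.symm q)) (c.base.symm.trans c'.base).source := by
  rw [← contMDiffOn_iff_contDiffOn]
  exact c'.contMDiffOn_base.comp (c.contMDiffOn_base_symm.mono inter_subset_left)
    (fun q hq => hq.2)

section Atlas

variable [IsManifold 𝓘(ℝ, Fin m → ℝ) ∞ M] [IsSmoothFiberBundle m n π]

theorem AdaptedChart.mem_jetTransition_source (c c' : AdaptedChart m n π) (k : ℕ)
    (z : JetModel m n k) :
    z ∈ ((c.jetPartialEquiv k).symm.trans (c'.jetPartialEquiv k)).source ↔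
      (z.1, z.2 (MultiIndex.zero m k)) ∈ (c.total.symm.trans c'.total).source := by
  constructor
  · rintro ⟨h1, h2⟩
    have h1' : (z.1, z.2 (MultiIndex.zero m k)) ∈ c.total.target := h1
    refine ⟨h1', ?_⟩
    change (c.jetOfCoord k z).toTotal ∈ c'.total.source at h2
    rw [c.jetOfCoord_eq z h1'] at h2
    change (c.polySection z h1').toFun (c.polySection z h1').pt ∈ c'.total.source at h2
    rwa [c.polySection_value] at h2
  · rintro ⟨h1, h2⟩
    have h1' : (z.1, z.2 (MultiIndex.zero m k)) ∈ c.total.target := h1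
    refine ⟨h1', ?_⟩
    change (c.jetOfCoord k z).toTotal ∈ c'.total.source
    rw [c.jetOfCoord_eq z h1']
    change (c.polySection z h1').toFun (c.polySection z h1').pt ∈ c'.total.source
    rwa [c.polySection_value]

theorem AdaptedChart.isOpen_jetTransition_source (c c' : AdaptedChart m n π) (k : ℕ) :
    IsOpen ((c.jetPartialEquiv k).symm.trans (c'.jetPartialEquiv k)).source := by
  have h : ((c.jetPartialEquiv k).symm.trans (c'.jetPartialEquiv k)).source =
      (fun z : JetModel m n k => (z.1, z.2 (MultiIndex.zero m k))) ⁻¹'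
        (c.total.symm.trans c'.total).source :=
    Set.ext fun z => c.mem_jetTransition_source c' k z
  rw [h]
  exact (c.total.symm.trans c'.total).open_source.preimage (by fun_prop)

theorem AdaptedChart.contDiffOn_jetTransition (c c' : AdaptedChart m n π) (k : ℕ) :
    ContDiffOn ℝ ∞ ((c.jetPartialEquiv k).symm.trans (c'.jetPartialEquiv k))
      ((c.jetPartialEquiv k).symm.trans (c'.jetPartialEquiv k)).source := by
  have hS := c.mem_jetTransition_source c' k
  set S := ((c.jetPartialEquiv k).symm.trans (c'.jetPartialEquiv k)).source with hSdef
  -- the base point in the new coordinates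
  have hbase : ∀ z ∈ S, z.1 ∈ (c.base.symm.trans c'.base).source := by
    intro z hz
    obtain ⟨h1, h2⟩ := (hS z).1 hz
    have h1' : (z.1, z.2 (MultiIndex.zero m k)) ∈ c.total.target := h1
    refine ⟨c.fst_mem_target h1', ?_⟩
    have h3 := c'.proj_mem _ h2
    have h4 := c.total_fst _ (c.total.map_target h1')
    rw [c.total.right_inv h1'] at h4
    have h5 : c.base.symm z.1 = π (c.total.symm (z.1, z.2 (MultiIndex.zero m k))) := by
      have h6 := congrArg c.base.symm h4
      rwa [c.base.left_inv (c.proj_mem _ (c.total.map_target h1'))] at h6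
    change c.base.symm z.1 ∈ c'.base.source
    rw [h5]
    exact h3
  have hy : ContDiffOn ℝ ∞ (fun z : JetModel m n k => c'.base (c.base.symm z.1)) S :=
    (c.contDiffOn_baseTransition c').comp contDiffOn_fst hbase
  -- the sections, in the new coordinates
  let ψ : (Fin m → ℝ) → (Fin m → ℝ) := fun y => c.base (c'.base.symm y)
  let G : JetModel m n k → (Fin m → ℝ) → (Fin n → ℝ) := fun z y =>
    (c'.total (c.total.symm (ψ y, taylorPoly z (ψ y)))).2
  let W0 : Set (JetModel m n k × (Fin m → ℝ)) :=
    {p | p.2 ∈ (c'.base.symm.trans c.base).source}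
  have hW0 : IsOpen W0 := (c'.base.symm.trans c.base).open_source.preimage continuous_snd
  have hφ : ContDiffOn ℝ ∞ (fun p : JetModel m n k × (Fin m → ℝ) =>
      (ψ p.2, taylorPoly p.1 (ψ p.2))) W0 := by
    have h1 : ContDiffOn ℝ ∞ (fun p : JetModel m n k × (Fin m → ℝ) => ψ p.2) W0 :=
      (c'.contDiffOn_baseTransition c).comp contDiffOn_snd (fun p hp => hp)
    have h2 : ContDiffOn ℝ ∞ (fun p : JetModel m n k × (Fin m → ℝ) => (p.1, ψ p.2)) W0 :=
      contDiffOn_fst.prodMk h1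
    have h3 : ContDiffOn ℝ ∞ (fun p : JetModel m n k × (Fin m → ℝ) =>
        taylorPoly p.1 (ψ p.2)) W0 :=
      ContDiff.comp_contDiffOn
        (g := fun p : JetModel m n k × (Fin m → ℝ) => taylorPoly p.1 p.2)
        (f := fun p : JetModel m n k × (Fin m → ℝ) => (p.1, ψ p.2))
        contDiff_taylorPoly h2
    exact h1.prodMk h3
  let W : Set (JetModel m n k × (Fin m → ℝ)) := W0 ∩ (fun p : JetModel m n k × (Fin m → ℝ) =>
      (ψ p.2, taylorPoly p.1 (ψ p.2))) ⁻¹' (c.total.symm.trans c'.total).source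
  have hW : IsOpen W := hφ.continuousOn.isOpen_inter_preimage hW0
    (c.total.symm.trans c'.total).open_source
  have hG : ContDiffOn ℝ ∞ (fun p : JetModel m n k × (Fin m → ℝ) => G p.1 p.2) W :=
    (ContDiffOn.comp (c.contDiffOn_totalTransition c') (hφ.mono inter_subset_left)
      (fun p hp => hp.2)).snd
  have hmem : ∀ z ∈ S, (z, c'.base (c.base.symm z.1)) ∈ W := by
    intro z hz
    have h1 : z.1 ∈ c.base.target ∧ c.base.symm z.1 ∈ c'.base.source := hbase z hz
    have h2 : ψ (c'.base (c.base.symm z.1)) = z.1 := by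
      change c.base (c'.base.symm (c'.base (c.base.symm z.1))) = z.1
      rw [c'.base.left_inv h1.2, c.base.right_inv h1.1]
    refine ⟨⟨c'.base.map_source h1.2, ?_⟩, ?_⟩
    · change c'.base.symm (c'.base (c.base.symm z.1)) ∈ c.base.source
      rw [c'.base.left_inv h1.2]
      exact c.base.map_target h1.1
    · change (ψ (c'.base (c.base.symm z.1)), taylorPoly z (ψ (c'.base (c.base.symm z.1)))) ∈
        (c.total.symm.trans c'.total).source
      rw [h2, taylorPoly_self]
      exact (hS z).1 hz
  have hmain : ContDiffOn ℝ ∞ (fun z : JetModel m n k => ((c'.base (c.base.symm z.1),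
      fun I : MultiIndex m k => multiDeriv I.1 (G z) (c'.base (c.base.symm z.1))) :
        JetModel m n k)) S := by
    refine hy.prodMk (contDiffOn_pi.2 fun I => ?_)
    exact ContDiffOn.comp
      (g := fun p : JetModel m n k × (Fin m → ℝ) => iterPartial (directions I.1) (G p.1) p.2)
      (f := fun z : JetModel m n k => (z, c'.base (c.base.symm z.1)))
      (iterPartial_param hW hG (directions I.1)) (contDiffOn_id.prodMk hy) hmem
  refine hmain.congr fun z hz => ?_
  have hz1 : (z.1, z.2 (MultiIndex.zero m k)) ∈ c.total.target := ((hS z).1 hz).1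
  have hb : z.1 ∈ c.base.target ∧ c.base.symm z.1 ∈ c'.base.source := hbase z hz
  have hval := c.polySection_value z hz1
  have hs : (c.polySection z hz1).toFun (c.polySection z hz1).pt ∈ c.total.source := by
    rw [hval]; exact c.total.map_target hz1
  have hs' : (c.polySection z hz1).toFun (c.polySection z hz1).pt ∈ c'.total.source := by
    rw [hval]; exact ((hS z).1 hz).2
  change c'.jetCoord k (c.jetOfCoord k z) = _
  rw [c.jetOfCoord_eq z hz1, c'.jetCoord_jet k _ hs']
  refine Prod.ext rfl (funext fun I => ?_)
  refine (iterPartial_eventuallyEq ?_ _).eq_of_nhds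
  refine (c.localRep_transition c' _ hs hs').trans ?_
  have hc : ContinuousAt ψ (c'.base (c.base.symm z.1)) := by
    refine ContinuousAt.comp ?_ (c'.base.continuousAt_symm (c'.base.map_source hb.2))
    rw [c'.base.left_inv hb.2]
    exact c.base.continuousAt (c.base.map_target hb.1)
  have h2 : ψ (c'.base (c.base.symm z.1)) = z.1 := by
    change c.base (c'.base.symm (c'.base (c.base.symm z.1))) = z.1
    rw [c'.base.left_inv hb.2, c.base.right_inv hb.1]
  have h3 : ∀ᶠ y in 𝓝 (c'.base (c.base.symm z.1)),
      c.localRep (c.polySection z hz1) (ψ y) = taylorPoly z (ψ y) := by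
    have h4 : ∀ᶠ x in 𝓝 (ψ (c'.base (c.base.symm z.1))),
        c.localRep (c.polySection z hz1) x = taylorPoly z x := by
      rw [h2]
      exact c.localRep_polySection z hz1
    exact hc.eventually h4
  filter_upwards [h3] with y hy
  change (c'.total (c.total.symm (ψ y, c.localRep (c.polySection z hz1) (ψ y)))).2 = _
  rw [hy]

variable (m n π) in
/-- The natural charts of `J^kπ` are compatible. -/
def jetCore (k : ℕ) : ChartedSpaceCore (JetModel m n k) (Jet m n π k) where
  atlas := Set.range fun c : AdaptedChart m n π => c.jetPartialEquiv k
  chartAt j := (exists_adaptedChart (m := m) (n := n) (π := π) j.toTotal).choose.jetPartialEquiv k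
  mem_chart_source j :=
    (exists_adaptedChart (m := m) (n := n) (π := π) j.toTotal).choose_spec
  chart_mem_atlas _ := ⟨_, rfl⟩
  open_source := by
    rintro _ _ ⟨c, rfl⟩ ⟨c', rfl⟩
    exact c.isOpen_jetTransition_source c' k
  continuousOn_toFun := by
    rintro _ _ ⟨c, rfl⟩ ⟨c', rfl⟩
    exact (c.contDiffOn_jetTransition c' k).continuousOn

instance Jet.instTopologicalSpace (k : ℕ) : TopologicalSpace (Jet m n π k) :=
  (jetCore m n π k).toTopologicalSpace

instance Jet.instChartedSpace (k : ℕ) : ChartedSpace (JetModel m n k) (Jet m n π k) :=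
  (jetCore m n π k).toChartedSpace

/-- The natural chart `(x^i, u^α_I)` of `J^kπ` induced by adapted coordinates of `E`. -/
def AdaptedChart.jetChart (c : AdaptedChart m n π) (k : ℕ) :
    OpenPartialHomeomorph (Jet m n π k) (JetModel m n k) :=
  (jetCore m n π k).openPartialHomeomorph (c.jetPartialEquiv k) ⟨c, rfl⟩

instance Jet.instIsManifold (k : ℕ) : IsManifold 𝓘(ℝ, JetModel m n k) ∞ (Jet m n π k) := by
  have h : ∀ e ∈ atlas (JetModel m n k) (Jet m n π k), ∃ c : AdaptedChart m n π,
      e = c.jetChart k := by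
    intro e he
    have he' : e ∈ ⋃ (e : PartialEquiv (Jet m n π k) (JetModel m n k))
      (he : e ∈ (jetCore m n π k).atlas), {(jetCore m n π k).openPartialHomeomorph e he} := he
    simp only [mem_iUnion, mem_singleton_iff] at he'
    obtain ⟨_, ⟨c, rfl⟩, h⟩ := he'
    exact ⟨c, h⟩
  refine isManifold_of_contDiffOn _ _ _ fun e e' he he' => ?_
  obtain ⟨c, rfl⟩ := h e he
  obtain ⟨c', rfl⟩ := h e' he'
  simp only [modelWithCornersSelf_coe, modelWithCornersSelf_coe_symm, Function.id_comp,
    Function.comp_id, preimage_id, range_id, inter_univ]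
  exact c.contDiffOn_jetTransition c' k

end Atlas

end Jets

/-! ### Differential forms and vector fields on manifolds -/

section Forms

variable {H : Type*} [NormedAddCommGroup H] [NormedSpace ℝ H]
  {X : Type*} [TopologicalSpace X] [ChartedSpace H X]

variable (H X) in
/-- Differential `p`-forms on the manifold `X` (not necessarily smooth). -/
abbrev DiffForm (p : ℕ) : Type _ := ∀ x : X, TangentSpace 𝓘(ℝ, H) x [⋀^Fin p]→L[ℝ] ℝ

/-- The local expression of a differential form in a chart, i.e. its pullback by the inverse of the
chart. -/
def DiffForm.inChart {p : ℕ} (θ : DiffForm H X p) (φ : OpenPartialHomeomorph X H) :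
    H → H [⋀^Fin p]→L[ℝ] ℝ :=
  fun y => (θ (φ.symm y)).compContinuousLinearMap (mfderiv 𝓘(ℝ, H) 𝓘(ℝ, H) φ.symm y)

/-- `θ ∈ Ω^p(X)`: the form `θ` is `C^∞`. -/
def DiffForm.IsSmooth {p : ℕ} (θ : DiffForm H X p) : Prop :=
  ∀ x : X, ContDiffOn ℝ ∞ (θ.inChart (chartAt H x)) (chartAt H x).target

/-- The exterior derivative `dθ`, computed in the preferred chart at each point. -/
def DiffForm.d {p : ℕ} (θ : DiffForm H X p) : DiffForm H X (p + 1) :=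
  fun x => (extDeriv (θ.inChart (chartAt H x)) (chartAt H x x)).compContinuousLinearMap
    (mfderiv 𝓘(ℝ, H) 𝓘(ℝ, H) (chartAt H x) x)

variable (H X) in
/-- Vector fields on `X` (not necessarily smooth). -/
abbrev VecField : Type _ := ∀ x : X, TangentSpace 𝓘(ℝ, H) x

/-- `V ∈ 𝔛(X)`: the vector field `V` is `C^∞`, as a section of the tangent bundle. -/
def VecField.IsSmooth [IsManifold 𝓘(ℝ, H) ∞ X] (V : VecField H X) : Prop :=
  ContMDiff 𝓘(ℝ, H) 𝓘(ℝ, H).tangent ∞ fun x => (⟨x, V x⟩ : TangentBundle 𝓘(ℝ, H) X)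

/-- The local expression of a vector field in a chart. -/
def VecField.inChart (V : VecField H X) (φ : OpenPartialHomeomorph X H) : H → H :=
  fun y => mfderiv 𝓘(ℝ, H) 𝓘(ℝ, H) φ (φ.symm y) (V (φ.symm y))

/-- The interior product `i(V)θ`; it is `0` for a form of degree `0`. -/
def DiffForm.interior (V : VecField H X) : {p : ℕ} → DiffForm H X p → DiffForm H X (p - 1)
  | 0, _ => fun _ => 0
  | _ + 1, θ => fun x => ContinuousAlternatingMap.curryLeft (E := H) (θ x) (V x)

/-- The Lie derivative of a form: with `w_i` the components of the tangent vectors `v_i` in the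
preferred chart at `x`,
`(L(V)θ)(v_1, …, v_p) = (D_V θ)(w_1, …, w_p) + ∑ᵢ θ(w_1, …, D_{w_i} V, …, w_p)`,
where `D` is the derivative of the components. -/
def DiffForm.lieDeriv {p : ℕ} (V : VecField H X) (θ : DiffForm H X p) (x : X)
    (v : Fin p → TangentSpace 𝓘(ℝ, H) x) : ℝ :=
  let φ := chartAt H x
  let w : Fin p → H := fun i => mfderiv 𝓘(ℝ, H) 𝓘(ℝ, H) φ x (v i)
  fderiv ℝ (θ.inChart φ) (φ x) (V.inChart φ (φ x)) w +
    ∑ i, θ.inChart φ (φ x) (Function.update w i (fderiv ℝ (V.inChart φ) (φ x) (w i)))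

variable {H' : Type*} [NormedAddCommGroup H'] [NormedSpace ℝ H']
  {Y : Type*} [TopologicalSpace Y] [ChartedSpace H' Y]

/-- `V ∈ 𝔛^V(f)`: `V` is a smooth `f`-vertical vector field. -/
def VecField.IsVertical [IsManifold 𝓘(ℝ, H) ∞ X] (V : VecField H X) (f : X → Y) : Prop :=
  V.IsSmooth ∧ ∀ x, mfderiv 𝓘(ℝ, H) 𝓘(ℝ, H') f x (V x) = 0

variable (H' : Type*) [NormedAddCommGroup H'] [NormedSpace ℝ H'] [ChartedSpace H' Y] in
/-- `θ` is `f`-semibasic: `i(V)θ = 0` for every `f`-vertical vector field `V`. -/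
def DiffForm.IsSemibasic [IsManifold 𝓘(ℝ, H) ∞ X] {p : ℕ} (θ : DiffForm H X p) (f : X → Y) :
    Prop :=
  ∀ V : VecField H X, V.IsVertical (H' := H') f → θ.interior V = 0

variable (H' : Type*) [NormedAddCommGroup H'] [NormedSpace ℝ H'] [ChartedSpace H' Y] in
/-- `θ` is `f`-projectable (`f`-basic): `i(V)θ = 0` and `L(V)θ = 0` for every `f`-vertical vector
field `V`. -/
def DiffForm.IsProjectable [IsManifold 𝓘(ℝ, H) ∞ X] {p : ℕ} (θ : DiffForm H X p) (f : X → Y) :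
    Prop :=
  ∀ V : VecField H X, V.IsVertical (H' := H') f →
    θ.interior V = 0 ∧ ∀ x v, θ.lieDeriv V x v = 0

end Forms

/-! ### The Poincaré–Cartan form of a second-order Lagrangian -/

/-- The form `d^mx = dx^1 ∧ … ∧ dx^m` on `ℝ^m`. -/
def stdVolume (m : ℕ) : (Fin m → ℝ) [⋀^Fin m]→L[ℝ] ℝ :=
  { (Matrix.detRowAlternating : (Fin m → ℝ) [⋀^Fin m]→ₗ[ℝ] ℝ) with
    cont := by
      change Continuous fun v : Fin m → Fin m → ℝ => Matrix.det (Matrix.of v)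
      exact Continuous.matrix_det continuous_id }

/-- The multi-index `I + 1_i`. -/
def MultiIndex.addOne {m k : ℕ} (I : MultiIndex m k) (i : Fin m) : MultiIndex m (k + 1) :=
  ⟨I.1 + Pi.single i 1, by
    simp only [Pi.add_apply, Finset.sum_add_distrib, Finset.sum_pi_single', Finset.mem_univ,
      if_true]
    exact Nat.succ_le_succ I.2⟩

/-- The multi-index `1_i`. -/
def MultiIndex.one {m : ℕ} (k : ℕ) (i : Fin m) : MultiIndex m (k + 1) :=
  (MultiIndex.zero m k).addOne i

/-- The multi-index `1_i + 1_j`. -/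
def MultiIndex.two {m : ℕ} (k : ℕ) (i j : Fin m) : MultiIndex m (k + 2) :=
  (MultiIndex.one k i).addOne j

section Coordinates

variable {m n : ℕ}

/-- The projection `J^kπ → J^lπ`, `l ≤ k`, in natural coordinates. -/
def truncate {k l : ℕ} (h : l ≤ k) (z : JetModel m n k) : JetModel m n l :=
  (z.1, fun I => z.2 ⟨I.1, I.2.trans h⟩)

/-- `∂F/∂x^i` for a function `F` of the coordinates of `J^kπ`. -/
def derivBase {k : ℕ} (i : Fin m) (F : JetModel m n k → ℝ) (z : JetModel m n k) : ℝ :=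
  fderiv ℝ F z (Pi.single i 1, 0)

/-- `∂F/∂u^α_I` for a function `F` of the coordinates of `J^kπ`. -/
def derivFiber {k : ℕ} (I : MultiIndex m k) (α : Fin n) (F : JetModel m n k → ℝ)
    (z : JetModel m n k) : ℝ :=
  fderiv ℝ F z (0, Pi.single I (Pi.single α 1))

/-- The coordinate total derivative
`D_iF = ∂F/∂x^i + ∑_{α, |I| ≤ k} u^α_{I+1_i} ∂F/∂u^α_I`, a function on `J^{k+1}π`. -/
def totalDeriv {k : ℕ} (i : Fin m) (F : JetModel m n k → ℝ) (z : JetModel m n (k + 1)) : ℝ :=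
  derivBase i F (truncate k.le_succ z) +
    ∑ I : MultiIndex m k, ∑ α, z.2 (I.addOne i) α * derivFiber I α F (truncate k.le_succ z)

/-- The combinatorial factor `n(ij)`. -/
def nFactor (i j : Fin m) : ℝ := if i = j then 1 else 2

/-- `L^{ij}_α = (1/n(ij)) ∂L/∂u^α_{1_i+1_j}`, as a function of the coordinates of `J^2π`. -/
def coordLij (F : JetModel m n 2 → ℝ) (i j : Fin m) (α : Fin n) (z : JetModel m n 2) : ℝ :=
  1 / nFactor i j * derivFiber (MultiIndex.two 0 i j) α F z

/-- `L^i_α = ∂L/∂u^α_i - ∑_j D_j L^{ij}_α`, as a function of the coordinates of `J^3π`. -/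
def coordLi (F : JetModel m n 2 → ℝ) (i : Fin m) (α : Fin n) (z : JetModel m n 3) : ℝ :=
  derivFiber (MultiIndex.one 1 i) α F (truncate (by norm_num) z) -
    ∑ j, totalDeriv j (coordLij F i j α) z

/-- The form `d^mx` on the coordinate space of `J^kπ`. -/
def volumeForm (m n k : ℕ) : JetModel m n k [⋀^Fin m]→L[ℝ] ℝ :=
  (stdVolume m).compContinuousLinearMap (ContinuousLinearMap.fst ℝ _ _)

/-- The `1`-form `du^α_I` on the coordinate space of `J^kπ`. -/
def duForm {k : ℕ} (I : MultiIndex m k) (α : Fin n) : JetModel m n k →L[ℝ] ℝ :=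
  ((ContinuousLinearMap.proj α : (Fin n → ℝ) →L[ℝ] ℝ).comp
    (ContinuousLinearMap.proj I : (MultiIndex m k → Fin n → ℝ) →L[ℝ] (Fin n → ℝ))).comp
    (ContinuousLinearMap.snd ℝ _ _)

/-- The wedge product `η ∧ β` of a `1`-form and a `p`-form:
`(η ∧ β)(v_0, …, v_p) = ∑_a (-1)^a η(v_a) β(v_0, …, v̂_a, …, v_p)`. -/
def wedgeOne {H : Type*} [NormedAddCommGroup H] [NormedSpace ℝ H] {p : ℕ}
    (η : H →L[ℝ] ℝ) (β : H [⋀^Fin p]→L[ℝ] ℝ) : H [⋀^Fin (p + 1)]→L[ℝ] ℝ :=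
  .alternatizeUncurryFin (η.smulRight β)

/-- The `m`-form `η ∧ d^{m-1}x_i` for a `1`-form `η`, where `d^{m-1}x_i = i(∂/∂x^i) d^mx`. -/
def wedgeVolume {n k : ℕ} : {m : ℕ} → (JetModel m n k →L[ℝ] ℝ) → Fin m →
    JetModel m n k [⋀^Fin m]→L[ℝ] ℝ
  | 0, _, i => i.elim0
  | m + 1, η, i => wedgeOne η ((volumeForm (m + 1) n k).curryLeft (Pi.single i 1, 0))

/-- The coordinate expression of the Poincaré–Cartan form of a Lagrangian with coordinate expression
`F`:
`L^i_α du^α ∧ d^{m-1}x_i + L^{ij}_α du^α_i ∧ d^{m-1}x_j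
  + (L - L^i_α u^α_i - L^{ij}_α u^α_{1_i+1_j}) d^mx`. -/
def coordTheta (F : JetModel m n 2 → ℝ) (z : JetModel m n 3) :
    JetModel m n 3 [⋀^Fin m]→L[ℝ] ℝ :=
  (∑ α, ∑ i, coordLi F i α z • wedgeVolume (duForm (MultiIndex.zero m 3) α) i) +
  (∑ α, ∑ i, ∑ j, coordLij F i j α (truncate (by norm_num) z) •
    wedgeVolume (duForm (MultiIndex.one 2 i) α) j) +
  (F (truncate (by norm_num) z) - (∑ α, ∑ i, coordLi F i α z * z.2 (MultiIndex.one 2 i) α) -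
    ∑ α, ∑ i, ∑ j, coordLij F i j α (truncate (by norm_num) z) *
      z.2 (MultiIndex.two 1 i j) α) • volumeForm m n 3

end Coordinates

section PoincareCartan

variable {m n : ℕ} {M : Type u} {E : Type v}
  [TopologicalSpace M] [ChartedSpace (Fin m → ℝ) M]
  [TopologicalSpace E] [ChartedSpace ((Fin m → ℝ) × (Fin n → ℝ)) E] {π : E → M}

/-- A volume form on `M`: a smooth nowhere vanishing `m`-form. -/
def IsVolumeForm (vol : DiffForm (Fin m → ℝ) M m) : Prop :=
  vol.IsSmooth ∧ ∀ x, vol x ≠ 0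

/-- The adapted coordinates satisfy `vol = dx^1 ∧ … ∧ dx^m`. -/
def AdaptedChart.IsNatural (c : AdaptedChart m n π) (vol : DiffForm (Fin m → ℝ) M m) : Prop :=
  ∀ y ∈ c.base.target, vol.inChart c.base y = stdVolume m

variable [IsManifold 𝓘(ℝ, Fin m → ℝ) ∞ M] [IsSmoothFiberBundle m n π]

/-- The coordinate expression of a Lagrangian function `L : J^2π → ℝ`. -/
def AdaptedChart.lagrangian (c : AdaptedChart m n π) (L : Jet m n π 2 → ℝ) :
    JetModel m n 2 → ℝ :=
  fun z => L ((c.jetChart 2).symm z)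

/-- The coefficient function `L^i_α` on the domain of the natural chart of `J^3π`. -/
def AdaptedChart.Li (c : AdaptedChart m n π) (L : Jet m n π 2 → ℝ) (i : Fin m) (α : Fin n) :
    Jet m n π 3 → ℝ :=
  fun p => coordLi (c.lagrangian L) i α (c.jetChart 3 p)

/-- The coefficient function `L^{ij}_α` on the domain of the natural chart of `J^3π`. -/
def AdaptedChart.Lij (c : AdaptedChart m n π) (L : Jet m n π 2 → ℝ) (i j : Fin m) (α : Fin n) :
    Jet m n π 3 → ℝ :=
  fun p => coordLij (c.lagrangian L) i j α (truncate (by norm_num) (c.jetChart 3 p))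

/-- `Θ ∈ Ω^m(J^3π)` is the Poincaré–Cartan form of the second-order Lagrangian `L vol`: it is given by
the coordinate expression `coordTheta` in all natural coordinates with `vol = d^mx`. -/
def IsPoincareCartanForm (vol : DiffForm (Fin m → ℝ) M m) (L : Jet m n π 2 → ℝ)
    (Θ : DiffForm (JetModel m n 3) (Jet m n π 3) m) : Prop :=
  Θ.IsSmooth ∧ ∀ c : AdaptedChart m n π, c.IsNatural vol →
    ∀ z ∈ (c.jetChart 3).target, Θ.inChart (c.jetChart 3) z = coordTheta (c.lagrangian L) z

end PoincareCartan

/-!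
Why the three conditions are equivalent. Let `X` be `π^3_s`-vertical with `s ≥ 1`. In natural
coordinates `Θ` only involves `dx^i`, `du^α` and `du^α_i`, so `i(X)Θ = 0` identically. Hence

* Cartan's formula reduces to `L(X)Θ = i(X)dΘ` (`DiffForm.lieDeriv_eq_d`), which gives the
  equivalence of the first two conditions. It is applied in the preferred charts, where the Lie
  derivative and the exterior derivative are defined; no natural coordinates are needed here.
* In natural coordinates `i(X)dΘ` at a point is the derivative of the coefficients of `Θ` along the
  vector `w` given by `X` (`extDeriv_coordTheta_cons_eq_zero_iff`). In the derivative of the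
  coefficient of `d^mx`, the terms `dL(w)` and `∑ L^{ij}_α w^α_{1_i+1_j}` cancel
  (`fderiv_truncate_eq_sum`; the factors `1/n(ij)` account for the symmetry of second derivatives),
  and what remains is a combination of the `dL^i_α(w)` and `dL^{ij}_α(w)`. As the forms
  `du^α ∧ d^{m-1}x_i` and `du^α_i ∧ d^{m-1}x_j` are linearly independent
  (`wedgeVolume_update_single`), `i(X)dΘ = 0` at the point if and only if all `dL^i_α(w)` and
  `dL^{ij}_α(w)` vanish.

The last equivalence is pointwise, so a vertical field never has to be extended or cut off. To use it
everywhere, natural coordinates must exist around every point (`exists_isNatural`): a volume form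
`ρ d^mx` becomes `d^mx` when one coordinate is replaced by a primitive of `ρ` in its direction.
This fails only for `m = 0`, where natural coordinates exist only if the volume form takes the value
`1`; but then all jet manifolds coincide and vertical fields are zero.
-/

/-! ### Cartan's formula for a form annihilated by a vector field -/

section Cartan

variable {H : Type*} [NormedAddCommGroup H] [NormedSpace ℝ H] {p : ℕ}

/-- If `i(V)θ = 0` near `y`, then Cartan's formula `L(V)θ = i(V)dθ + d i(V)θ` loses its last
term. -/
theorem extDeriv_cons_of_interior_eq_zero {θ : H → H [⋀^Fin p]→L[ℝ] ℝ} {V : H → H} {y : H}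
    (hθ : DifferentiableAt ℝ θ y) (hV : DifferentiableAt ℝ V y)
    (h0 : ∀ᶠ x in 𝓝 y, ∀ v : Fin p → H, (∃ a, v a = V x) → θ x v = 0) (w : Fin p → H) :
    extDeriv θ y (Fin.cons (V y) w : Fin (p + 1) → H) =
      fderiv ℝ θ y (V y) w + ∑ i, θ y (Function.update w i (fderiv ℝ V y (w i))) := by
  rw [extDeriv, ContinuousAlternatingMap.alternatizeUncurryFin_apply, Fin.sum_univ_succ]
  congr 1
  · simp
  · refine Finset.sum_congr rfl fun i _ => ?_
    obtain ⟨q, rfl⟩ : ∃ q, p = q + 1 := ⟨p - 1, by have := i.pos; omega⟩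
    -- differentiate `θ(w_1, …, V, …, w_p) = 0` in the direction `w_i`
    have h1 : fderiv ℝ (fun x => θ x (fun j => Function.update w i (V x) j)) y = 0 := by
      rw [Filter.EventuallyEq.fderiv_eq (f := fun _ => (0 : ℝ))]
      · simp
      · filter_upwards [h0] with x hx
        exact hx _ ⟨i, Function.update_self i (V x) w⟩
    have hd : ∀ j, HasFDerivAt (fun x => Function.update w i (V x) j)
        (if j = i then fderiv ℝ V y else 0) y := by
      intro j
      by_cases hj : j = i
      · subst hj
        simpa using hV.hasFDerivAt
      · simpa [hj] using hasFDerivAt_const (w j) y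
    have h2 := fderiv_continuousAlternatingMap_apply_apply hθ
      (fun j => (hd j).differentiableAt) (w i)
    simp only [h1, (hd _).fderiv] at h2
    rw [Finset.sum_eq_single i] at h2
    rotate_left
    · intro j _ hj
      refine (θ y).map_coord_zero j ?_
      simp [hj]
    · simp
    have h5 : (Fin.removeNth i.succ (Fin.cons (V y) w : Fin (q + 2) → H)) =
        Matrix.vecCons (V y) (Fin.removeNth i w) := by
      funext j
      refine Fin.cases ?_ (fun j => ?_) j
      · simp [Fin.removeNth]
      · simp [Fin.removeNth]
    have h6 := (fderiv ℝ θ y (w i)).neg_one_pow_smul_map_insertNth i (V y) (Fin.removeNth i w)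
    rw [Fin.insertNth_removeNth] at h6
    simp only [Fin.cons_succ, h5, ← h6, Fin.val_succ, pow_succ]
    simp only [_root_.zero_apply, if_true] at h2
    have h7 : ((-1 : ℝ) ^ (i : ℕ)) * (-1) ^ (i : ℕ) = 1 := by
      rw [← mul_pow]; simp
    have h8 : Function.update (fun j => Function.update w i (V y) j) i (fderiv ℝ V y (w i)) =
        Function.update w i (fderiv ℝ V y (w i)) := by simp
    rw [h8] at h2
    change 0 = fderiv ℝ θ y (w i) (Function.update w i (V y)) + _ at h2
    simp only [zsmul_eq_mul, Int.cast_mul, Int.cast_pow, Int.cast_neg, Int.cast_one]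
    linear_combination (-(fderiv ℝ θ y (w i) (Function.update w i (V y)))) * h7 + h2

end Cartan

/-! ### The forms `η ∧ d^{m-1}x_i` on the coordinate space -/

section WedgeVolume

variable {m n k : ℕ}

theorem stdVolume_apply (v : Fin m → Fin m → ℝ) : stdVolume m v = Matrix.det (Matrix.of v) := rfl

theorem stdVolume_single : stdVolume m (fun i => Pi.single i 1) = 1 := by
  rw [stdVolume_apply, ← Matrix.det_one (n := Fin m) (R := ℝ)]
  congr 1
  ext i j
  simp [Matrix.one_apply, Pi.single_apply, eq_comm]

theorem volumeForm_eq_zero {v : Fin m → JetModel m n k} {a : Fin m} (ha : (v a).1 = 0) :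
    volumeForm m n k v = 0 :=
  (stdVolume m).map_coord_zero a ha

theorem volumeForm_single :
    volumeForm m n k (fun i => (Pi.single i 1, 0)) = 1 := stdVolume_single

theorem wedgeVolume_eq_zero {η : JetModel m n k →L[ℝ] ℝ} {i : Fin m}
    {v : Fin m → JetModel m n k} {a : Fin m} (h1 : (v a).1 = 0) (h2 : η (v a) = 0) :
    wedgeVolume η i v = 0 := by
  cases m with
  | zero => exact i.elim0
  | succ m =>
    simp only [wedgeVolume, wedgeOne, ContinuousAlternatingMap.alternatizeUncurryFin_apply]
    refine Finset.sum_eq_zero fun b _ => ?_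
    by_cases hb : b = a
    · subst hb
      simp [h2]
    · obtain ⟨c, hc⟩ := Fin.exists_succAbove_eq (Ne.symm hb)
      have h3 : volumeForm (m + 1) n k
          (Matrix.vecCons ((Pi.single i 1, 0) : JetModel (m + 1) n k) (b.removeNth v)) = 0 :=
        volumeForm_eq_zero (a := c.succ) (by
          simpa [Fin.removeNth, hc] using h1)
      simp [h3]

/-- The forms `η ∧ d^{m-1}x_j` are told apart by their values on the tuples in which the `i`-th
vector of the frame `∂/∂x^1, …, ∂/∂x^m` is replaced by a vertical vector. -/
theorem wedgeVolume_update_single {η : JetModel m n k →L[ℝ] ℝ}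
    (hη : ∀ x : Fin m → ℝ, η (x, 0) = 0) (i j : Fin m) (f : MultiIndex m k → Fin n → ℝ) :
    wedgeVolume η j (Function.update (fun i => (Pi.single i 1, 0)) i (0, f)) =
      if j = i then η (0, f) else 0 := by
  cases m with
  | zero => exact i.elim0
  | succ m =>
    simp only [wedgeVolume, wedgeOne, ContinuousAlternatingMap.alternatizeUncurryFin_apply]
    rw [Finset.sum_eq_single i]
    rotate_left
    · intro b _ hb
      simp [Function.update_of_ne hb, hη]
    · simp
    have h1 : i.removeNth (Function.update
        (fun i => ((Pi.single i 1, 0) : JetModel (m + 1) n k)) i (0, f)) =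
        i.removeNth (fun i => ((Pi.single i 1, 0) : JetModel (m + 1) n k)) := by
      funext c
      simp [Fin.removeNth, Fin.succAbove_ne]
    have h2 := (volumeForm (m + 1) n k).neg_one_pow_smul_map_insertNth i (Pi.single j 1, 0)
      (i.removeNth (fun i => ((Pi.single i 1, 0) : JetModel (m + 1) n k)))
    rw [Fin.insertNth_removeNth] at h2
    have h3 : volumeForm (m + 1) n k (Function.update
        (fun i => ((Pi.single i 1, 0) : JetModel (m + 1) n k)) i (Pi.single j 1, 0)) =
        if j = i then 1 else 0 := by
      split_ifs with h
      · subst h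
        rw [Function.update_eq_self j (fun i => ((Pi.single i 1, 0) : JetModel (m + 1) n k))]
        exact volumeForm_single
      · refine (volumeForm (m + 1) n k).map_eq_zero_of_eq _ (i := i) (j := j) ?_ (Ne.symm h)
        rw [Function.update_self, Function.update_of_ne h]
    rw [h3] at h2
    have h4 : ((-1 : ℝ) ^ (i : ℕ)) * (-1) ^ (i : ℕ) = 1 := by
      rw [← mul_pow]; simp
    simp only [h1, Function.update_self, ContinuousLinearMap.smulRight_apply,
      ContinuousAlternatingMap.smul_apply, ContinuousAlternatingMap.curryLeft_apply_apply, ← h2]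
    split_ifs with h
    · simp only [zsmul_eq_mul, smul_eq_mul, Int.cast_pow, Int.cast_neg, Int.cast_one]
      linear_combination (η (0, f)) * h4
    · simp

@[simp]
theorem duForm_apply (I : MultiIndex m k) (α : Fin n) (z : JetModel m n k) :
    duForm I α z = z.2 I α := rfl

end WedgeVolume

/-! ### Sums over multi-indices of length two -/

section MultiIndexSums

variable {m : ℕ}

theorem MultiIndex.one_val (k : ℕ) (i : Fin m) : (MultiIndex.one k i).1 = Pi.single i 1 := by
  simp [MultiIndex.one, MultiIndex.addOne, MultiIndex.zero]

theorem MultiIndex.two_val (k : ℕ) (i j : Fin m) :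
    (MultiIndex.two k i j).1 = Pi.single i 1 + Pi.single j 1 := by
  simp [MultiIndex.two, MultiIndex.addOne, MultiIndex.one_val]

theorem MultiIndex.one_injective (k : ℕ) :
    Function.Injective (MultiIndex.one k : Fin m → MultiIndex m (k + 1)) := by
  intro i j h
  have h1 := congrFun (congrArg Subtype.val h) i
  rw [MultiIndex.one_val, MultiIndex.one_val, Pi.single_eq_same] at h1
  by_contra hij
  rw [Pi.single_eq_of_ne hij] at h1
  omega

theorem MultiIndex.zero_ne_one (k : ℕ) (i : Fin m) :
    MultiIndex.zero m (k + 1) ≠ MultiIndex.one k i := by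
  intro h
  have h1 := congrFun (congrArg Subtype.val h) i
  rw [MultiIndex.one_val, Pi.single_eq_same] at h1
  simp [MultiIndex.zero] at h1

theorem single_add_single_eq_iff {a b i j : Fin m} :
    (Pi.single i 1 + Pi.single j 1 : Fin m → ℕ) = Pi.single a 1 + Pi.single b 1 ↔
      (i = a ∧ j = b) ∨ (i = b ∧ j = a) := by
  constructor
  · intro h
    have key : ∀ c : Fin m, ((if c = i then 1 else 0) + (if c = j then 1 else 0) : ℕ) =
        (if c = a then 1 else 0) + (if c = b then 1 else 0) := fun c => by
      have := congrFun h c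
      simpa [Pi.single_apply] using this
    have hi := key i
    have hj := key j
    have ha := key a
    grind
  · rintro (⟨rfl, rfl⟩ | ⟨rfl, rfl⟩)
    · rfl
    · exact add_comm _ _

theorem exists_single_add (I : Fin m → ℕ) {q : ℕ} (hI : ∑ i, I i = q + 1) :
    ∃ (a : Fin m) (J : Fin m → ℕ), I = J + Pi.single a 1 ∧ ∑ i, J i = q := by
  obtain ⟨a, -, ha⟩ : ∃ a ∈ Finset.univ, I a ≠ 0 := by
    by_contra! h
    rw [Finset.sum_eq_zero h] at hI
    omega
  have h1 : I = (I - Pi.single a 1) + Pi.single a 1 := by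
    funext c
    by_cases hc : c = a
    · subst hc
      simp
      omega
    · simp [hc]
  refine ⟨a, _, h1, ?_⟩
  rw [h1] at hI
  simp only [Pi.add_apply, Finset.sum_add_distrib, Finset.sum_pi_single', Finset.mem_univ,
    if_true] at hI
  omega

theorem MultiIndex.eq_cases (I : MultiIndex m 2) :
    I = MultiIndex.zero m 2 ∨ (∃ i, I = MultiIndex.one 1 i) ∨ ∃ i j, I = MultiIndex.two 0 i j := by
  have hz : ∀ J : Fin m → ℕ, ∑ i, J i = 0 → J = 0 := fun J hJ =>
    funext fun i => by simpa using (Finset.sum_eq_zero_iff.1 hJ) i (Finset.mem_univ i)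
  have h2 := I.2
  obtain h | h | h : ∑ i, I.1 i = 0 ∨ ∑ i, I.1 i = 0 + 1 ∨ ∑ i, I.1 i = 1 + 1 := by omega
  · exact Or.inl (Subtype.ext (hz _ h))
  · obtain ⟨a, J, h1, hJ⟩ := exists_single_add _ h
    refine Or.inr (Or.inl ⟨a, Subtype.ext ?_⟩)
    rw [h1, hz J hJ, MultiIndex.one_val, zero_add]
  · obtain ⟨a, J, h1, hJ⟩ := exists_single_add _ h
    obtain ⟨b, K, h3, hK⟩ := exists_single_add J hJ
    refine Or.inr (Or.inr ⟨b, a, Subtype.ext ?_⟩)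
    rw [h1, h3, hz K hK, MultiIndex.two_val, zero_add]

/-- The factor `n(ij)` compensates for the two pairs `(i, j)`, `(j, i)` which give the same
multi-index of length two. -/
theorem sum_multiIndex_two {g : MultiIndex m 2 → ℝ} (h0 : g (MultiIndex.zero m 2) = 0)
    (h1 : ∀ i, g (MultiIndex.one 1 i) = 0) :
    ∑ i, ∑ j, 1 / nFactor i j * g (MultiIndex.two 0 i j) = ∑ I, g I := by
  classical
  have hfib : ∀ I : MultiIndex m 2, g I = ∑ p : Fin m × Fin m,
      if MultiIndex.two 0 p.1 p.2 = I then 1 / nFactor p.1 p.2 * g I else 0 := by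
    intro I
    obtain rfl | ⟨i, rfl⟩ | ⟨a, b, rfl⟩ := I.eq_cases
    · simp [h0]
    · simp [h1]
    · have h2 : ∀ p : Fin m × Fin m, MultiIndex.two 0 p.1 p.2 = MultiIndex.two 0 a b ↔
          p = (a, b) ∨ p = (b, a) := by
        intro p
        rw [Subtype.ext_iff, MultiIndex.two_val, MultiIndex.two_val, single_add_single_eq_iff,
          Prod.ext_iff, Prod.ext_iff]
      simp only [h2]
      by_cases hab : a = b
      · subst hab
        simp [nFactor]
      · rw [← Finset.sum_filter]
        have h3 : (Finset.univ.filter fun p : Fin m × Fin m => p = (a, b) ∨ p = (b, a)) =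
            {(a, b), (b, a)} := by
          ext p; simp
        rw [h3, Finset.sum_pair (by simp [hab])]
        simp only [nFactor, hab, Ne.symm hab, if_false]
        ring
  calc ∑ i, ∑ j, 1 / nFactor i j * g (MultiIndex.two 0 i j)
      = ∑ p : Fin m × Fin m, 1 / nFactor p.1 p.2 * g (MultiIndex.two 0 p.1 p.2) :=
        (Fintype.sum_prod_type' fun i j => 1 / nFactor i j * g (MultiIndex.two 0 i j)).symm
    _ = ∑ p : Fin m × Fin m, ∑ I, if MultiIndex.two 0 p.1 p.2 = I then
          1 / nFactor p.1 p.2 * g I else 0 := Finset.sum_congr rfl fun p _ => by simp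
    _ = ∑ I, g I := by
        rw [Finset.sum_comm]
        exact Finset.sum_congr rfl fun I _ => (hfib I).symm

end MultiIndexSums

/-! ### The Poincaré–Cartan form in natural coordinates -/

section CoordinateForm

variable {m n : ℕ}

/-- The projection `J^kπ → J^lπ` in natural coordinates, as a continuous linear map. -/
def truncateCLM {k l : ℕ} (h : l ≤ k) : JetModel m n k →L[ℝ] JetModel m n l :=
  (ContinuousLinearMap.fst ℝ _ _).prod (ContinuousLinearMap.pi fun I =>
    (ContinuousLinearMap.proj (⟨I.1, I.2.trans h⟩ : MultiIndex m k)).comp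
      (ContinuousLinearMap.snd ℝ _ (MultiIndex m k → Fin n → ℝ)))

theorem coe_truncateCLM {k l : ℕ} (h : l ≤ k) :
    ⇑(truncateCLM (m := m) (n := n) h) = truncate h := rfl

theorem contDiffOn_derivFiber {k : ℕ} {F : JetModel m n k → ℝ} {T : Set (JetModel m n k)}
    (hT : IsOpen T) (hF : ContDiffOn ℝ ∞ F T) (I : MultiIndex m k) (α : Fin n) :
    ContDiffOn ℝ ∞ (derivFiber I α F) T :=
  (hF.fderiv_of_isOpen hT (by simp)).clm_apply contDiffOn_const

theorem contDiffOn_derivBase {k : ℕ} {F : JetModel m n k → ℝ} {T : Set (JetModel m n k)}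
    (hT : IsOpen T) (hF : ContDiffOn ℝ ∞ F T) (i : Fin m) :
    ContDiffOn ℝ ∞ (derivBase i F) T :=
  (hF.fderiv_of_isOpen hT (by simp)).clm_apply contDiffOn_const

theorem contDiffOn_comp_truncate {k l : ℕ} (h : l ≤ k) {F : JetModel m n l → ℝ}
    {T : Set (JetModel m n l)} (hF : ContDiffOn ℝ ∞ F T) :
    ContDiffOn ℝ ∞ (fun z => F (truncate h z)) (truncate h ⁻¹' T) :=
  hF.comp (truncateCLM h).contDiff.contDiffOn fun _ hz => hz

theorem contDiffOn_totalDeriv {k : ℕ} {F : JetModel m n k → ℝ} {T : Set (JetModel m n k)}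
    (hT : IsOpen T) (hF : ContDiffOn ℝ ∞ F T) (i : Fin m) :
    ContDiffOn ℝ ∞ (totalDeriv i F) (truncate k.le_succ ⁻¹' T) := by
  refine (contDiffOn_comp_truncate _ (contDiffOn_derivBase hT hF i)).add
    (ContDiffOn.sum fun I _ => ContDiffOn.sum fun α _ => ContDiffOn.mul ?_
      (contDiffOn_comp_truncate _ (contDiffOn_derivFiber hT hF I α)))
  exact (duForm (I.addOne i) α).contDiff.contDiffOn

theorem contDiffOn_coordLij {F : JetModel m n 2 → ℝ} {T : Set (JetModel m n 2)}
    (hT : IsOpen T) (hF : ContDiffOn ℝ ∞ F T) (i j : Fin m) (α : Fin n) :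
    ContDiffOn ℝ ∞ (coordLij F i j α) T :=
  contDiffOn_const.mul (contDiffOn_derivFiber hT hF _ α)

theorem contDiffOn_coordLi {F : JetModel m n 2 → ℝ} {T : Set (JetModel m n 2)}
    (hT : IsOpen T) (hF : ContDiffOn ℝ ∞ F T) (i : Fin m) (α : Fin n) :
    ContDiffOn ℝ ∞ (coordLi F i α) (truncate (Nat.le_succ 2) ⁻¹' T) :=
  (contDiffOn_comp_truncate _ (contDiffOn_derivFiber hT hF _ α)).sub
    (ContDiffOn.sum fun j _ => contDiffOn_totalDeriv hT (contDiffOn_coordLij hT hF i j α) j)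

/-- The form vanishes on every tuple containing a vector vertical over `J^1π`. -/
theorem coordTheta_eq_zero (F : JetModel m n 2 → ℝ) (z : JetModel m n 3)
    {v : Fin m → JetModel m n 3} {a : Fin m}
    (hv : truncate (by norm_num : 1 ≤ 3) (v a) = 0) : coordTheta F z v = 0 := by
  have hb : (v a).1 = 0 := congrArg Prod.fst hv
  have h0 : ∀ α, duForm (MultiIndex.zero m 3) α (v a) = 0 := fun α =>
    congrFun (congrFun (congrArg Prod.snd hv) (MultiIndex.zero m 1)) α
  have h1 : ∀ i α, duForm (MultiIndex.one 2 i) α (v a) = 0 := fun i α =>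
    congrFun (congrFun (congrArg Prod.snd hv) (MultiIndex.one 0 i)) α
  simp [coordTheta, wedgeVolume_eq_zero hb (h0 _), wedgeVolume_eq_zero hb (h1 _ _),
    volumeForm_eq_zero hb]

/-- Along a vector `w` vertical over `J^1π`, `dL(w) = ∑ L^{ij}_α w^α_{1_i+1_j}`. -/
theorem fderiv_truncate_eq_sum {F : JetModel m n 2 → ℝ} {w : JetModel m n 3}
    (z : JetModel m n 2) (hw : truncate (by norm_num : 1 ≤ 3) w = 0) :
    fderiv ℝ F z (truncate (by norm_num : 2 ≤ 3) w) =
      ∑ α, ∑ i, ∑ j, coordLij F i j α z * w.2 (MultiIndex.two 1 i j) α := by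
  have hb : w.1 = 0 := congrArg Prod.fst hw
  have h0 : ∀ α, w.2 (MultiIndex.zero m 3) α = 0 := fun α =>
    congrFun (congrFun (congrArg Prod.snd hw) (MultiIndex.zero m 1)) α
  have h1 : ∀ i α, w.2 (MultiIndex.one 2 i) α = 0 := fun i α =>
    congrFun (congrFun (congrArg Prod.snd hw) (MultiIndex.one 0 i)) α
  have hI : ∀ I : MultiIndex m 2, ∑ i, I.1 i ≤ 3 := fun I => I.2.trans (by norm_num)
  have hdec : truncate (by norm_num : 2 ≤ 3) w = ∑ α, ∑ I : MultiIndex m 2,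
      w.2 ⟨I.1, hI I⟩ α • ((0, Pi.single I (Pi.single α 1)) : JetModel m n 2) := by
    refine Prod.ext ?_ ?_
    · simp [truncate, hb, Prod.fst_sum]
    · funext I α
      simp [truncate, Prod.snd_sum, Finset.sum_apply, Pi.single_apply, Finset.sum_ite_eq]
  rw [hdec, map_sum]
  refine Finset.sum_congr rfl fun α _ => ?_
  rw [map_sum]
  simp only [map_smul, smul_eq_mul]
  rw [← sum_multiIndex_two (g := fun I => w.2 ⟨I.1, hI I⟩ α *
    fderiv ℝ F z (0, Pi.single I (Pi.single α 1)))]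
  · refine Finset.sum_congr rfl fun i _ => Finset.sum_congr rfl fun j _ => ?_
    rw [coordLij, derivFiber, mul_assoc]
    congr 1
    exact mul_comm _ _
  · exact mul_eq_zero_of_left (h0 α) _
  · exact fun i => mul_eq_zero_of_left (h1 i α) _

/-- The coordinate form is differentiable; in its derivative along `w` vertical over `J^1π`, the
terms of the coefficient of `d^mx` which involve `w` itself cancel. -/
theorem fderiv_coordTheta {F : JetModel m n 2 → ℝ} {z w : JetModel m n 3}
    (hF : DifferentiableAt ℝ F (truncate (by norm_num) z))
    (hA : ∀ i α, DifferentiableAt ℝ (coordLi F i α) z)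
    (hB : ∀ i j α, DifferentiableAt ℝ (fun z : JetModel m n 3 =>
      coordLij F i j α (truncate (by norm_num) z)) z)
    (hw : truncate (by norm_num : 1 ≤ 3) w = 0) :
    DifferentiableAt ℝ (coordTheta F) z ∧ fderiv ℝ (coordTheta F) z w =
      (∑ α, ∑ i, fderiv ℝ (coordLi F i α) z w • wedgeVolume (duForm (MultiIndex.zero m 3) α) i) +
      (∑ α, ∑ i, ∑ j, fderiv ℝ (fun z : JetModel m n 3 =>
          coordLij F i j α (truncate (by norm_num) z)) z w •
        wedgeVolume (duForm (MultiIndex.one 2 i) α) j) -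
      ((∑ α, ∑ i, z.2 (MultiIndex.one 2 i) α * fderiv ℝ (coordLi F i α) z w) +
        ∑ α, ∑ i, ∑ j, z.2 (MultiIndex.two 1 i j) α * fderiv ℝ (fun z : JetModel m n 3 =>
          coordLij F i j α (truncate (by norm_num) z)) z w) • volumeForm m n 3 := by
  have h1 : ∀ i α, w.2 (MultiIndex.one 2 i) α = 0 := fun i α =>
    congrFun (congrFun (congrArg Prod.snd hw) (MultiIndex.one 0 i)) α
  have hu : ∀ (I : MultiIndex m 3) (α : Fin n),
      HasFDerivAt (fun z : JetModel m n 3 => z.2 I α) (duForm I α) z :=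
    fun I α => (duForm I α).hasFDerivAt
  have hF' := hF.hasFDerivAt.comp z (truncateCLM (n := n) (m := m)
    (by norm_num : 2 ≤ 3)).hasFDerivAt
  have H := ((HasFDerivAt.fun_sum (u := Finset.univ) fun α _ => HasFDerivAt.fun_sum
      (u := Finset.univ) fun i _ => (hA i α).hasFDerivAt.smul_const
        (wedgeVolume (duForm (MultiIndex.zero m 3) α) i)).add
    (HasFDerivAt.fun_sum (u := Finset.univ) fun α _ => HasFDerivAt.fun_sum
      (u := Finset.univ) fun i _ => HasFDerivAt.fun_sum (u := Finset.univ) fun j _ =>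
        (hB i j α).hasFDerivAt.smul_const (wedgeVolume (duForm (MultiIndex.one 2 i) α) j))).add
    (((hF'.sub (HasFDerivAt.fun_sum (u := Finset.univ) fun α _ => HasFDerivAt.fun_sum
      (u := Finset.univ) fun i _ => (hA i α).hasFDerivAt.mul (hu (MultiIndex.one 2 i) α))).sub
    (HasFDerivAt.fun_sum (u := Finset.univ) fun α _ => HasFDerivAt.fun_sum
      (u := Finset.univ) fun i _ => HasFDerivAt.fun_sum (u := Finset.univ) fun j _ =>
        (hB i j α).hasFDerivAt.mul (hu (MultiIndex.two 1 i j) α))).smul_const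
          (volumeForm m n 3))
  have H' : HasFDerivAt (coordTheta F) _ z := H
  refine ⟨H'.differentiableAt, ?_⟩
  rw [H'.fderiv]
  have h3 := fderiv_truncate_eq_sum (F := F) (truncate (by norm_num) z) hw
  simp [coe_truncateCLM, h3, h1, Finset.sum_add_distrib]
  module

/-- In natural coordinates, `i(w)dΘ = 0` at a point if and only if the derivatives of all the
coefficients `L^i_α` and `L^{ij}_α` along `w` vanish there. -/
theorem extDeriv_coordTheta_cons_eq_zero_iff {F : JetModel m n 2 → ℝ} {z w : JetModel m n 3}
    (hF : DifferentiableAt ℝ F (truncate (by norm_num) z))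
    (hA : ∀ i α, DifferentiableAt ℝ (coordLi F i α) z)
    (hB : ∀ i j α, DifferentiableAt ℝ (fun z : JetModel m n 3 =>
      coordLij F i j α (truncate (by norm_num) z)) z)
    (hw : truncate (by norm_num : 1 ≤ 3) w = 0) :
    (∀ v : Fin m → JetModel m n 3,
      extDeriv (coordTheta F) z (Fin.cons w v : Fin (m + 1) → JetModel m n 3) = 0) ↔
    (∀ i α, fderiv ℝ (coordLi F i α) z w = 0) ∧
    (∀ i j α, fderiv ℝ (fun z : JetModel m n 3 =>
      coordLij F i j α (truncate (by norm_num) z)) z w = 0) := by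
  obtain ⟨hd, hΘ⟩ := fderiv_coordTheta hF hA hB hw
  have h1 : ∀ v : Fin m → JetModel m n 3,
      extDeriv (coordTheta F) z (Fin.cons w v : Fin (m + 1) → JetModel m n 3) =
        fderiv ℝ (coordTheta F) z w v := by
    intro v
    rw [extDeriv_cons_of_interior_eq_zero (V := fun _ => w) hd (differentiableAt_const w)
      (Filter.Eventually.of_forall fun x v ⟨a, ha⟩ =>
        coordTheta_eq_zero F x (a := a) (by rw [ha]; exact hw))]
    simp only [fderiv_fun_const, Pi.zero_apply, _root_.zero_apply, add_eq_left]
    exact Finset.sum_eq_zero fun i _ => (coordTheta F z).map_coord_zero i (by simp)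
  simp only [h1]
  constructor
  · intro h
    rw [hΘ] at h
    have hvol : ∀ (i : Fin m) (f : MultiIndex m 3 → Fin n → ℝ), volumeForm m n 3
        (Function.update (fun i => (Pi.single i 1, 0)) i (0, f)) = 0 := fun i f =>
      volumeForm_eq_zero (a := i) (by simp)
    have hwedge : ∀ (I : MultiIndex m 3) (α : Fin n) (i j : Fin m)
        (f : MultiIndex m 3 → Fin n → ℝ), wedgeVolume (duForm I α) j
        (Function.update (fun i => (Pi.single i 1, 0)) i (0, f)) = if j = i then f I α else 0 :=
      fun I α i j f => wedgeVolume_update_single (fun _ => rfl) i j f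
    constructor
    -- evaluate on the frame `∂/∂x^i` with one vector replaced by `∂/∂u^α` or `∂/∂u^α_i`
    · intro i α
      have h2 := h (Function.update (fun i => (Pi.single i 1, 0)) i
        (0, Pi.single (MultiIndex.zero m 3) (Pi.single α 1)))
      simpa [hvol, hwedge, Pi.single_apply, ite_apply,
        fun i => (MultiIndex.zero_ne_one (m := m) 2 i).symm] using h2
    · intro i j α
      have h2 := h (Function.update (fun i => (Pi.single i 1, 0)) j
        (0, Pi.single (MultiIndex.one 2 i) (Pi.single α 1)))
      simpa [hvol, hwedge, Pi.single_apply, ite_apply, MultiIndex.zero_ne_one,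
        (MultiIndex.one_injective 2).eq_iff] using h2
  · rintro ⟨h2, h3⟩ v
    rw [hΘ]
    simp [h2, h3]

end CoordinateForm

/-! ### Forms and vector fields in charts -/

section Charts

variable {H : Type*} [NormedAddCommGroup H] [NormedSpace ℝ H]
  {X : Type*} [TopologicalSpace X] [ChartedSpace H X] {p : ℕ}

/-- A chart of `X`, not necessarily in its atlas, which is a diffeomorphism onto its image. -/
def IsSmoothChart (φ : OpenPartialHomeomorph X H) : Prop :=
  ContMDiffOn 𝓘(ℝ, H) 𝓘(ℝ, H) ∞ φ φ.source ∧ ContMDiffOn 𝓘(ℝ, H) 𝓘(ℝ, H) ∞ φ.symm φ.target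

/-- The differential at `x` of a chart, with the tangent space at `x` identified with the model
space (as it is by definition). -/
def chartDeriv (φ : OpenPartialHomeomorph X H) (x : X) : H →L[ℝ] H :=
  mfderiv 𝓘(ℝ, H) 𝓘(ℝ, H) φ x

/-- The differential at `y` of the inverse of a chart. -/
def chartDerivSymm (φ : OpenPartialHomeomorph X H) (y : H) : H →L[ℝ] H :=
  mfderiv 𝓘(ℝ, H) 𝓘(ℝ, H) φ.symm y

theorem IsSmoothChart.mdifferentiable {φ : OpenPartialHomeomorph X H} (hφ : IsSmoothChart φ) :
    φ.MDifferentiable 𝓘(ℝ, H) 𝓘(ℝ, H) :=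
  ⟨hφ.1.mdifferentiableOn (by simp), hφ.2.mdifferentiableOn (by simp)⟩

theorem IsSmoothChart.symm_comp_deriv {φ : OpenPartialHomeomorph X H} (hφ : IsSmoothChart φ)
    {x : X} (hx : x ∈ φ.source) (v : H) : chartDerivSymm φ (φ x) (chartDeriv φ x v) = v :=
  congrArg (fun l : H →L[ℝ] H => l v) (hφ.mdifferentiable.symm_comp_deriv hx)

theorem IsSmoothChart.chartDeriv_injective {φ : OpenPartialHomeomorph X H}
    (hφ : IsSmoothChart φ) {x : X} (hx : x ∈ φ.source) : Function.Injective (chartDeriv φ x) :=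
  hφ.mdifferentiable.mfderiv_injective hx

theorem IsSmoothChart.chartDeriv_surjective {φ : OpenPartialHomeomorph X H}
    (hφ : IsSmoothChart φ) {x : X} (hx : x ∈ φ.source) : Function.Surjective (chartDeriv φ x) :=
  hφ.mdifferentiable.mfderiv_surjective hx

theorem isSmoothChart_of_mem_atlas [IsManifold 𝓘(ℝ, H) ∞ X] {φ : OpenPartialHomeomorph X H}
    (hφ : φ ∈ atlas H X) : IsSmoothChart φ :=
  ⟨contMDiffOn_of_mem_maximalAtlas (IsManifold.subset_maximalAtlas hφ),
    contMDiffOn_symm_of_mem_maximalAtlas (IsManifold.subset_maximalAtlas hφ)⟩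

theorem IsSmoothChart.contDiffAt_transition {φ ψ : OpenPartialHomeomorph X H}
    (hφ : IsSmoothChart φ) (hψ : IsSmoothChart ψ) {x : X} (hx : x ∈ φ.source)
    (hx' : x ∈ ψ.source) : ContDiffAt ℝ ∞ (ψ ∘ φ.symm) (φ x) := by
  rw [← contMDiffAt_iff_contDiffAt]
  refine ContMDiffAt.comp (φ x) ?_ (hφ.2.contMDiffAt (φ.open_target.mem_nhds (φ.map_source hx)))
  rw [φ.left_inv hx]
  exact hψ.1.contMDiffAt (ψ.open_source.mem_nhds hx')

theorem IsSmoothChart.fderiv_transition {φ ψ : OpenPartialHomeomorph X H}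
    (hφ : IsSmoothChart φ) (hψ : IsSmoothChart ψ) {x : X} (hx : x ∈ φ.source)
    (hx' : x ∈ ψ.source) (v : H) :
    fderiv ℝ (ψ ∘ φ.symm) (φ x) (chartDeriv φ x v) = chartDeriv ψ x v := by
  have h1 : ψ =ᶠ[𝓝 x] (ψ ∘ φ.symm) ∘ φ := by
    filter_upwards [φ.open_source.mem_nhds hx] with y hy
    simp [φ.left_inv hy]
  rw [chartDeriv, chartDeriv, h1.mfderiv_eq, mfderiv_comp x
    ((hφ.contDiffAt_transition hψ hx hx').contMDiffAt.mdifferentiableAt (by simp))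
    (hφ.mdifferentiable.mdifferentiableAt hx), mfderiv_eq_fderiv]
  rfl

theorem DiffForm.inChart_apply (θ : DiffForm H X p) {φ : OpenPartialHomeomorph X H} {x : X}
    (hx : x ∈ φ.source) (v : Fin p → H) :
    θ.inChart φ (φ x) v = θ x (fun i => chartDerivSymm φ (φ x) (v i)) :=
  congrArg (fun q : X => (θ q : H [⋀^Fin p]→L[ℝ] ℝ)
    (fun i => chartDerivSymm φ (φ x) (v i))) (φ.left_inv hx)

theorem DiffForm.apply_eq_inChart (θ : DiffForm H X p) {φ : OpenPartialHomeomorph X H}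
    (hφ : IsSmoothChart φ) {x : X} (hx : x ∈ φ.source) (v : Fin p → H) :
    θ x v = θ.inChart φ (φ x) (fun i => chartDeriv φ x (v i)) := by
  rw [θ.inChart_apply hx]
  simp only [hφ.symm_comp_deriv hx]

/-- Two local expressions of a form are pullbacks of each other by the change of coordinates. -/
theorem DiffForm.inChart_eq_pullback (θ : DiffForm H X p) {φ ψ : OpenPartialHomeomorph X H}
    (hφ : IsSmoothChart φ) (hψ : IsSmoothChart ψ) {x : X} (hx : x ∈ φ.source)
    (hx' : x ∈ ψ.source) :
    θ.inChart φ (φ x) =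
      (θ.inChart ψ (ψ x)).compContinuousLinearMap (fderiv ℝ (ψ ∘ φ.symm) (φ x)) := by
  ext v
  choose u hu using fun i => hφ.chartDeriv_surjective hx (v i)
  obtain rfl : (fun i => chartDeriv φ x (u i)) = v := funext hu
  rw [← θ.apply_eq_inChart hφ hx, θ.apply_eq_inChart hψ hx']
  simp only [← hφ.fderiv_transition hψ hx hx']
  rfl

/-- The exterior derivative may be computed in any smooth chart. -/
theorem DiffForm.d_apply_eq_inChart [IsManifold 𝓘(ℝ, H) ∞ X] (θ : DiffForm H X p)
    {φ : OpenPartialHomeomorph X H} (hφ : IsSmoothChart φ) {x : X} (hx : x ∈ φ.source)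
    (hθ : DifferentiableAt ℝ (θ.inChart φ) (φ x)) (v : Fin (p + 1) → H) :
    θ.d x v = extDeriv (θ.inChart φ) (φ x) (fun i => chartDeriv φ x (v i)) := by
  have hψ : IsSmoothChart (chartAt H x) := isSmoothChart_of_mem_atlas (chart_mem_atlas H x)
  have hx' := mem_chart_source H x
  have hcomp : (φ ∘ (chartAt H x).symm) (chartAt H x x) = φ x := by simp
  have h1 : θ.inChart (chartAt H x) =ᶠ[𝓝 (chartAt H x x)] fun y =>
      (θ.inChart φ ((φ ∘ (chartAt H x).symm) y)).compContinuousLinearMap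
        (fderiv ℝ (φ ∘ (chartAt H x).symm) y) := by
    have h2 : ∀ᶠ y in 𝓝 (chartAt H x x), y ∈ (chartAt H x).target ∧
        (chartAt H x).symm y ∈ φ.source := by
      refine ((chartAt H x).open_target.eventually_mem (mem_chart_target H x)).and ?_
      refine ((chartAt H x).continuousAt_symm (mem_chart_target H x)).preimage_mem_nhds ?_
      simpa using φ.open_source.mem_nhds hx
    filter_upwards [h2] with y hy
    have h3 := θ.inChart_eq_pullback hψ hφ ((chartAt H x).map_target hy.1) hy.2
    rwa [(chartAt H x).right_inv hy.1] at h3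
  have hf := hψ.contDiffAt_transition hφ hx' hx
  have h4 := extDeriv_pullback
    (hcomp.symm ▸ hθ :
      DifferentiableAt ℝ (θ.inChart φ) ((φ ∘ (chartAt H x).symm) (chartAt H x x))) hf (by simp only [minSmoothness_of_isRCLikeNormedField]; exact WithTop.coe_le_coe.2 le_top)
  change extDeriv (θ.inChart (chartAt H x)) (chartAt H x x)
    (fun i => chartDeriv (chartAt H x) x (v i)) = _
  rw [h1.extDeriv_eq, h4, hcomp]
  simp only [← hψ.fderiv_transition hφ hx' hx]
  rfl

theorem VecField.IsSmooth.differentiableAt_inChart [IsManifold 𝓘(ℝ, H) ∞ X] {V : VecField H X}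
    (hV : V.IsSmooth) (x : X) :
    DifferentiableAt ℝ (V.inChart (chartAt H x)) (chartAt H x x) := by
  have hψ : IsSmoothChart (chartAt H x) := isSmoothChart_of_mem_atlas (chart_mem_atlas H x)
  have h1 := (Bundle.contMDiffAt_totalSpace.1 (hV x)).2
  have h2 := ContMDiffAt.comp (chartAt H x x) (by simpa using h1)
    (hψ.2.contMDiffAt ((chartAt H x).open_target.mem_nhds (mem_chart_target H x)))
  refine (contMDiffAt_iff_contDiffAt.1 h2).differentiableAt (by simp) |>.congr_of_eventuallyEq ?_
  filter_upwards [(chartAt H x).open_target.mem_nhds (mem_chart_target H x)] with y hy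
  have h3 := (chartAt H x).map_target hy
  simp only [VecField.inChart, Function.comp]
  rw [mfderiv_chartAt_eq_tangentCoordChange h3]
  rfl

/-- If a form is annihilated by a vector field `V`, then `L(V)θ = i(V)dθ`. -/
theorem DiffForm.lieDeriv_eq_d [IsManifold 𝓘(ℝ, H) ∞ X] {θ : DiffForm H X p} (hθ : θ.IsSmooth)
    {V : VecField H X} (hV : V.IsSmooth)
    (h0 : ∀ x (v : Fin p → H), (∃ a, v a = V x) → θ x v = 0) (x : X) (v : Fin p → H) :
    θ.lieDeriv V x v = θ.d x (Fin.cons (V x) v : Fin (p + 1) → H) := by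
  have hx' := mem_chart_target H x
  have hd : DifferentiableAt ℝ (θ.inChart (chartAt H x)) (chartAt H x x) :=
    ((hθ x).contDiffAt ((chartAt H x).open_target.mem_nhds hx')).differentiableAt (by simp)
  have hψ : IsSmoothChart (chartAt H x) := isSmoothChart_of_mem_atlas (chart_mem_atlas H x)
  have hVx : V.inChart (chartAt H x) (chartAt H x x) = chartDeriv (chartAt H x) x (V x) :=
    congrArg (fun q : X => chartDeriv (chartAt H x) q (V q))
      ((chartAt H x).left_inv (mem_chart_source H x))
  have h1 := extDeriv_cons_of_interior_eq_zero hd (hV.differentiableAt_inChart x) (by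
    filter_upwards [(chartAt H x).open_target.mem_nhds hx'] with y hy w hw
    obtain ⟨a, ha⟩ := hw
    refine h0 ((chartAt H x).symm y) (fun i => chartDerivSymm (chartAt H x) y (w i)) ⟨a, ?_⟩
    have h2 := hψ.symm_comp_deriv ((chartAt H x).map_target hy) (V ((chartAt H x).symm y))
    rw [(chartAt H x).right_inv hy] at h2
    rw [ha]
    exact h2) (fun i => chartDeriv (chartAt H x) x (v i))
  refine Eq.trans h1.symm ?_
  rw [hVx]
  change _ = extDeriv (θ.inChart (chartAt H x)) (chartAt H x x) (fun i =>
    chartDeriv (chartAt H x) x ((Fin.cons (V x) v : Fin (p + 1) → H) i))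
  congr 1
  funext i
  refine Fin.cases ?_ (fun i => ?_) i
  · rfl
  · rfl

end Charts

/-! ### Straightening a volume form -/

section Straightening

/-- Smooth dependence of an integral on parameters, read off from the smoothness of
convolutions. -/
theorem contDiff_intervalIntegral_param {P : Type*} [NormedAddCommGroup P] [NormedSpace ℝ P]
    {K : P → ℝ → ℝ} (hK : ContDiff ℝ ∞ fun q : P × ℝ => K q.1 q.2) :
    ContDiff ℝ ∞ fun x => ∫ t in (0 : ℝ)..1, K x t := by
  let η : ContDiffBump (0 : ℝ) := ⟨1, 2, one_pos, one_lt_two⟩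
  have h1 := MeasureTheory.contDiffOn_convolution_right_with_param_comp (μ := MeasureTheory.volume)
    (n := ⊤) (ContinuousLinearMap.mul ℝ ℝ) (s := (univ : Set P)) (v := fun _ => (0 : ℝ))
    (f := (Ioc (0 : ℝ) 1).indicator fun _ => (1 : ℝ)) (g := fun x t => η t * K x (-t))
    (k := tsupport η) contDiffOn_const isOpen_univ η.hasCompactSupport
    (fun x t _ ht => by simp [image_eq_zero_of_notMem_tsupport ht])
    (((MeasureTheory.locallyIntegrable_const (1 : ℝ)).indicator measurableSet_Ioc))
    (by
      refine ContDiff.contDiffOn ?_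
      exact (η.contDiff.comp contDiff_snd).mul
        (hK.comp (contDiff_fst.prodMk contDiff_snd.neg)))
  refine (congrArg (ContDiff ℝ ∞) (funext fun x => ?_)).mpr (contDiffOn_univ.1 h1)
  rw [intervalIntegral.integral_of_le zero_le_one, ← MeasureTheory.integral_indicator
    measurableSet_Ioc, MeasureTheory.convolution]
  refine MeasureTheory.integral_congr_ae (Filter.Eventually.of_forall fun t => ?_)
  by_cases ht : t ∈ Ioc (0 : ℝ) 1
  · have h2 : η (-t) = 1 := η.one_of_mem_closedBall (by
      simp only [Metric.mem_closedBall, dist_zero_right, norm_neg, Real.norm_eq_abs]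
      exact abs_le.2 ⟨by linarith [ht.1], ht.2⟩)
    simp [ht, h2]
  · simp [ht]

variable {m : ℕ}

/-- A primitive in the direction of the coordinate `x^i` of a smooth function. -/
theorem exists_primitive (i : Fin m) {ρ : (Fin m → ℝ) → ℝ} (hρ : ContDiff ℝ ∞ ρ) :
    ∃ g : (Fin m → ℝ) → ℝ, ContDiff ℝ ∞ g ∧ ∀ x, fderiv ℝ g x (Pi.single i 1) = ρ x := by
  have hg : ContDiff ℝ ∞ fun x : Fin m → ℝ =>
      x i * ∫ t in (0 : ℝ)..1, ρ (Function.update x i (t * x i)) := by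
    refine (contDiff_apply ℝ ℝ i).mul (contDiff_intervalIntegral_param (hρ.comp ?_))
    refine contDiff_pi.2 fun j => ?_
    by_cases hj : j = i
    · subst hj
      simp only [Function.update_self]
      fun_prop
    · simp only [Function.update_of_ne hj]
      fun_prop
  refine ⟨_, hg, fun x => ?_⟩
  have hline : ∀ s : ℝ, x + s • Pi.single i (1 : ℝ) = Function.update x i (x i + s) := by
    intro s
    funext j
    by_cases hj : j = i
    · subst hj; simp
    · simp [hj]
  have hcont : Continuous fun t : ℝ => ρ (Function.update x i t) :=
    hρ.continuous.comp (continuous_const.update i continuous_id)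
  have h1 : ∀ y : ℝ, (y * ∫ t in (0 : ℝ)..1, ρ (Function.update x i (t * y))) =
      ∫ t in (0 : ℝ)..y, ρ (Function.update x i t) := by
    intro y
    have := intervalIntegral.smul_integral_comp_mul_right (a := 0) (b := 1)
      (fun t => ρ (Function.update x i t)) y
    simpa using this
  -- on the line through `x` the function is the integral of `ρ` over `[0, x^i]`
  rw [← (hg.differentiable (by simp) x).lineDeriv_eq_fderiv, lineDeriv]
  simp only [hline, Function.update_self, Function.update_idem, h1]
  have h2 := (hcont.integral_hasStrictDerivAt 0 (x i)).hasDerivAt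
  have h3 : HasDerivAt (fun s : ℝ => ∫ t in (0 : ℝ)..x i + s, ρ (Function.update x i t))
      (ρ x) 0 := by
    have := HasDerivAt.comp_const_add (x i) 0 (by simpa using h2)
    exact this
  exact h3.deriv

/-- A local diffeomorphism of `ℝ^m` which pulls `d^mx` back to a given volume form `ρ d^mx`: replace
one of the coordinates by a primitive of `ρ`. -/
theorem exists_straightening (i : Fin m) {ρ : (Fin m → ℝ) → ℝ} {U : Set (Fin m → ℝ)}
    (hU : IsOpen U) (hρ : ContDiffOn ℝ ∞ ρ U) (hρ0 : ∀ x ∈ U, ρ x ≠ 0) {a : Fin m → ℝ}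
    (ha : a ∈ U) :
    ∃ Φ : OpenPartialHomeomorph (Fin m → ℝ) (Fin m → ℝ), a ∈ Φ.source ∧ Φ.source ⊆ U ∧
      ContDiffOn ℝ ∞ Φ Φ.source ∧ ContDiffOn ℝ ∞ Φ.symm Φ.target ∧
      ∀ x ∈ Φ.source, stdVolume m (fun j => fderiv ℝ Φ x (Pi.single j 1)) = ρ x := by
  -- a global smooth function which agrees with `ρ` near `a`
  obtain ⟨r, hr, hrU⟩ := Metric.nhds_basis_closedBall.mem_iff.1 (hU.mem_nhds ha)
  let χ : ContDiffBump a := ⟨r / 2, r, by positivity, by linarith⟩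
  have hχ : tsupport χ ⊆ U := by rw [χ.tsupport_eq]; exact hrU
  have hρ' : ContDiff ℝ ∞ fun x => χ x * ρ x := by
    rw [contDiff_iff_contDiffAt]
    intro x
    by_cases hx : x ∈ tsupport χ
    · exact χ.contDiff.contDiffAt.mul (hρ.contDiffAt (hU.mem_nhds (hχ hx)))
    · refine contDiffAt_const (c := (0 : ℝ)) |>.congr_of_eventuallyEq ?_
      filter_upwards [(isClosed_tsupport χ).isOpen_compl.mem_nhds hx] with y hy
      simp [image_eq_zero_of_notMem_tsupport hy]
  obtain ⟨g, hg, hgρ⟩ := exists_primitive i hρ'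
  set B := Metric.ball a (r / 2)
  have hBρ : ∀ x ∈ B, fderiv ℝ g x (Pi.single i 1) = ρ x := fun x hx => by
    rw [hgρ, χ.one_of_mem_closedBall (Metric.ball_subset_closedBall hx), one_mul]
  have hBU : B ⊆ U := (Metric.ball_subset_closedBall.trans
    (Metric.closedBall_subset_closedBall (by linarith))).trans hrU
  let Ψ : (Fin m → ℝ) → (Fin m → ℝ) := fun x => Function.update x i (g x)
  have hΨ : ContDiff ℝ ∞ Ψ := by
    refine contDiff_pi.2 fun j => ?_
    by_cases hj : j = i
    · subst hj
      simpa [Ψ] using hg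
    · simpa [Ψ, hj] using contDiff_apply ℝ ℝ j
  have hΨ' : ∀ x v, fderiv ℝ Ψ x v = Function.update v i (fderiv ℝ g x v) := by
    intro x v
    funext j
    have h1 : fderiv ℝ Ψ x v j = fderiv ℝ (fun y => Ψ y j) x v := by
      rw [fderiv_apply (hΨ.differentiable (by simp) x)]
      rfl
    rw [h1]
    by_cases hj : j = i
    · subst hj
      simp [Ψ]
    · simp only [Ψ, Function.update_of_ne hj]
      exact congrArg (fun l : (Fin m → ℝ) →L[ℝ] ℝ => l v)
        (ContinuousLinearMap.proj (R := ℝ) (φ := fun _ : Fin m => ℝ) j).fderiv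
  have hinv : ∀ x ∈ B, ∃ l : (Fin m → ℝ) ≃L[ℝ] (Fin m → ℝ),
      HasFDerivAt Ψ (l : (Fin m → ℝ) →L[ℝ] (Fin m → ℝ)) x := by
    intro x hx
    have hinj : Function.Injective (fderiv ℝ Ψ x) := by
      rw [injective_iff_map_eq_zero]
      intro v hv
      rw [hΨ'] at hv
      have h1 : v = v i • Pi.single i (1 : ℝ) := by
        funext j
        by_cases hj : j = i
        · subst hj; simp
        · simpa [hj] using congrFun hv j
      have h2 : fderiv ℝ g x v = 0 := by simpa using congrFun hv i
      rw [h1, map_smul, hBρ x hx, smul_eq_mul] at h2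
      rw [h1, (mul_eq_zero.1 h2).resolve_right (hρ0 x (hBU hx)), zero_smul]
    let l := (LinearEquiv.ofInjectiveEndo (fderiv ℝ Ψ x : (Fin m → ℝ) →ₗ[ℝ] (Fin m → ℝ))
      hinj).toContinuousLinearEquiv
    refine ⟨l, ?_⟩
    have h3 : (l : (Fin m → ℝ) →L[ℝ] (Fin m → ℝ)) = fderiv ℝ Ψ x := by
      ext v; rfl
    rw [h3]
    exact (hΨ.differentiable (by simp) x).hasFDerivAt
  have haB : a ∈ B := Metric.mem_ball_self (by positivity)
  obtain ⟨l, hl⟩ := hinv a haB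
  let Φ₀ := hΨ.contDiffAt.toOpenPartialHomeomorph Ψ (a := a) hl (by simp)
  let Φ := Φ₀.restrOpen B Metric.isOpen_ball
  have hΦs : Φ.source = Φ₀.source ∩ B := rfl
  have hΦ : ⇑Φ = Ψ := rfl
  refine ⟨Φ, ⟨hΨ.contDiffAt.mem_toOpenPartialHomeomorph_source hl (by simp), haB⟩,
    fun x hx => hBU hx.2, hΨ.contDiffOn, ?_, ?_⟩
  · intro y hy
    obtain ⟨l', hl'⟩ := hinv (Φ.symm y) (Φ.map_target hy).2
    exact (Φ.contDiffAt_symm hy hl' hΨ.contDiffAt).contDiffWithinAt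
  · intro x hx
    rw [hΦ, stdVolume_apply, ← hBρ x hx.2]
    have h1 : Matrix.of (fun j => fderiv ℝ Ψ x (Pi.single j 1)) =
        (1 : Matrix (Fin m) (Fin m) ℝ).updateCol i
          (fun j => fderiv ℝ g x (Pi.single j 1)) := by
      ext j k
      rw [Matrix.of_apply, hΨ', Matrix.updateCol_apply]
      by_cases hk : k = i
      · subst hk; simp
      · simp [hk, Matrix.one_apply, Pi.single_apply, eq_comm]
    rw [h1, ← Matrix.cramer_apply, Matrix.cramer_one]
    rfl

end Straightening

/-! ### Natural coordinates -/

section NaturalCharts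

variable {m n : ℕ} {M : Type u} {E : Type v}
  [TopologicalSpace M] [ChartedSpace (Fin m → ℝ) M]
  [TopologicalSpace E] [ChartedSpace ((Fin m → ℝ) × (Fin n → ℝ)) E] {π : E → M}

theorem eq_smul_stdVolume (τ : (Fin m → ℝ) [⋀^Fin m]→L[ℝ] ℝ) :
    τ = τ (fun i => Pi.single i 1) • stdVolume m := by
  have h := τ.toAlternatingMap.eq_smul_basis_det (Pi.basisFun ℝ (Fin m))
  rw [Pi.basisFun_det] at h
  ext v
  have h1 := congrArg (fun f : (Fin m → ℝ) [⋀^Fin m]→ₗ[ℝ] ℝ => f v) h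
  have h2 : ⇑(Pi.basisFun ℝ (Fin m)) = fun i => Pi.single i 1 := by
    funext i; simp
  rw [h2] at h1
  exact h1

/-- Around every point of `M` there are coordinates in which the volume form is `d^mx`. -/
theorem exists_chart_inChart_eq_stdVolume [IsManifold 𝓘(ℝ, Fin m → ℝ) ∞ M] (i : Fin m)
    {vol : DiffForm (Fin m → ℝ) M m} (hvol : IsVolumeForm vol) (x : M) :
    ∃ b : OpenPartialHomeomorph M (Fin m → ℝ), IsSmoothChart b ∧ x ∈ b.source ∧
      ∀ y ∈ b.target, vol.inChart b y = stdVolume m := by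
  set ψ := chartAt (Fin m → ℝ) x
  have hψ : IsSmoothChart ψ := isSmoothChart_of_mem_atlas (chart_mem_atlas _ x)
  let e : Fin m → Fin m → ℝ := fun j => Pi.single j 1
  let ρ : (Fin m → ℝ) → ℝ := fun y => vol.inChart ψ y e
  have hρ : ContDiffOn ℝ ∞ ρ ψ.target :=
    (ContinuousAlternatingMap.apply ℝ (Fin m → ℝ) ℝ e).contDiff.comp_contDiffOn (hvol.1 x)
  have hρ0 : ∀ y ∈ ψ.target, ρ y ≠ 0 := by
    intro y hy h0
    have h1 : vol.inChart ψ y = 0 := by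
      rw [eq_smul_stdVolume (vol.inChart ψ y)]
      change ρ y • _ = _
      rw [h0, zero_smul]
    refine hvol.2 (ψ.symm y) ?_
    ext v
    have h2 := vol.apply_eq_inChart hψ (ψ.map_target hy) v
    rw [ψ.right_inv hy, h1] at h2
    exact h2
  obtain ⟨Φ, haΦ, hΦU, hΦ, hΦ', hdet⟩ := exists_straightening i ψ.open_target hρ hρ0
    (mem_chart_target _ x)
  have hb : IsSmoothChart (ψ.trans Φ) :=
    ⟨hΦ.contMDiffOn.comp (hψ.1.mono inter_subset_left) fun p hp => hp.2,
      hψ.2.comp (hΦ'.contMDiffOn.mono inter_subset_left) fun p hp => hp.2⟩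
  refine ⟨ψ.trans Φ, hb, ⟨mem_chart_source _ x, haΦ⟩, fun y hy => ?_⟩
  obtain ⟨p, hp, rfl⟩ : ∃ p ∈ (ψ.trans Φ).source, (ψ.trans Φ) p = y :=
    ⟨_, (ψ.trans Φ).map_target hy, (ψ.trans Φ).right_inv hy⟩
  have hp1 : p ∈ ψ.source := hp.1
  have hp2 : ψ p ∈ Φ.source := hp.2
  have h1 := vol.inChart_eq_pullback hψ hb hp1 hp
  have h2 : (ψ.trans Φ) ∘ ψ.symm =ᶠ[𝓝 (ψ p)] Φ := by
    filter_upwards [ψ.open_target.mem_nhds (ψ.map_source hp1)] with z hz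
    change Φ (ψ (ψ.symm z)) = Φ z
    rw [ψ.right_inv hz]
  rw [h2.fderiv_eq] at h1
  set τ := vol.inChart (ψ.trans Φ) ((ψ.trans Φ) p)
  -- `Φ` has Jacobian determinant `ρ`, so the density of the form in the new chart is `1`
  have h3 : ρ (ψ p) = τ e * ρ (ψ p) := by
    calc ρ (ψ p) = τ (fun j => fderiv ℝ Φ (ψ p) (Pi.single j 1)) := by
          change vol.inChart ψ (ψ p) e = _
          rw [h1]
          rfl
      _ = τ e * ρ (ψ p) := by
          conv_lhs => rw [eq_smul_stdVolume τ]
          rw [← hdet _ hp2]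
          rfl
  have h4 : τ e = 1 := (mul_eq_right₀ (hρ0 _ (hΦU hp2))).1 h3.symm
  rw [eq_smul_stdVolume τ]
  change τ e • _ = _
  rw [h4, one_smul]

/-- The adapted coordinates obtained by a change of the coordinates of the base. -/
def AdaptedChart.changeBase (c : AdaptedChart m n π) (b : OpenPartialHomeomorph M (Fin m → ℝ))
    (hb : IsSmoothChart b) : AdaptedChart m n π where
  base := b
  total := c.total.trans ((c.base.symm.trans b).prod (OpenPartialHomeomorph.refl _))
  contMDiffOn_base := hb.1
  contMDiffOn_base_symm := hb.2
  contMDiffOn_total := by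
    have h1 : ContMDiffOn 𝓘(ℝ, Fin m → ℝ) 𝓘(ℝ, Fin m → ℝ) ∞ (fun y => b (c.base.symm y))
        (c.base.symm.trans b).source :=
      hb.1.comp (c.contMDiffOn_base_symm.mono inter_subset_left) fun y hy => hy.2
    have h2 : ContDiffOn ℝ ∞ (fun q : (Fin m → ℝ) × (Fin n → ℝ) =>
        (b (c.base.symm q.1), q.2)) ((c.base.symm.trans b).source ×ˢ univ) :=
      ((contMDiffOn_iff_contDiffOn.1 h1).comp contDiffOn_fst fun q hq => hq.1).prodMk
        contDiffOn_snd
    exact h2.contMDiffOn.comp (c.contMDiffOn_total.mono inter_subset_left) fun q hq => hq.2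
  contMDiffOn_total_symm := by
    have h1 : ContMDiffOn 𝓘(ℝ, Fin m → ℝ) 𝓘(ℝ, Fin m → ℝ) ∞ (fun y => c.base (b.symm y))
        (c.base.symm.trans b).target :=
      c.contMDiffOn_base.comp (hb.2.mono inter_subset_left) fun y hy => hy.2
    have h2 : ContDiffOn ℝ ∞ (fun q : (Fin m → ℝ) × (Fin n → ℝ) =>
        (c.base (b.symm q.1), q.2)) ((c.base.symm.trans b).target ×ˢ univ) :=
      ((contMDiffOn_iff_contDiffOn.1 h1).comp contDiffOn_fst fun q hq => hq.1).prodMk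
        contDiffOn_snd
    exact c.contMDiffOn_total_symm.comp (h2.contMDiffOn.mono inter_subset_left) fun q hq => hq.2
  proj_mem := by
    rintro e ⟨he, he2, -⟩
    have h1 : c.base.symm (c.total e).1 ∈ b.source := he2.2
    rwa [c.total_fst e he, c.base.left_inv (c.proj_mem e he)] at h1
  total_fst := by
    rintro e ⟨he, -⟩
    change b (c.base.symm (c.total e).1) = b (π e)
    rw [c.total_fst e he, c.base.left_inv (c.proj_mem e he)]

theorem exists_isNatural [IsManifold 𝓘(ℝ, Fin m → ℝ) ∞ M] [IsSmoothFiberBundle m n π]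
    (i : Fin m) {vol : DiffForm (Fin m → ℝ) M m} (hvol : IsVolumeForm vol) (e : E) :
    ∃ c : AdaptedChart m n π, c.IsNatural vol ∧ e ∈ c.total.source := by
  obtain ⟨c, hc⟩ := exists_adaptedChart (m := m) (n := n) (π := π) e
  obtain ⟨b, hb, hx, hnat⟩ := exists_chart_inChart_eq_stdVolume i hvol (π e)
  refine ⟨c.changeBase b hb, hnat, hc, ⟨?_, ?_⟩, mem_univ _⟩
  · change (c.total e).1 ∈ c.base.target
    rw [c.total_fst e hc]
    exact c.base.map_source (c.proj_mem e hc)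
  · change c.base.symm (c.total e).1 ∈ b.source
    rwa [c.total_fst e hc, c.base.left_inv (c.proj_mem e hc)]

end NaturalCharts

/-! ### The projections of the jet manifolds in natural coordinates -/

section JetCharts

variable {m n : ℕ} {M : Type u} {E : Type v}
  [TopologicalSpace M] [ChartedSpace (Fin m → ℝ) M]
  [TopologicalSpace E] [ChartedSpace ((Fin m → ℝ) × (Fin n → ℝ)) E] {π : E → M}

theorem toTotal_jetProj {k l : ℕ} (h : l ≤ k) (j : Jet m n π k) :
    (jetProj m n π h j).toTotal = j.toTotal := by
  obtain ⟨s, rfl⟩ := j.exists_jet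
  rfl

variable [IsManifold 𝓘(ℝ, Fin m → ℝ) ∞ M] [IsSmoothFiberBundle m n π]

theorem AdaptedChart.isSmoothChart_jetChart (c : AdaptedChart m n π) (k : ℕ) :
    IsSmoothChart (c.jetChart k) := by
  refine isSmoothChart_of_mem_atlas ?_
  change c.jetChart k ∈ ⋃ (e : PartialEquiv (Jet m n π k) (JetModel m n k))
    (he : e ∈ (jetCore m n π k).atlas), {(jetCore m n π k).openPartialHomeomorph e he}
  simp only [mem_iUnion, mem_singleton_iff]
  exact ⟨c.jetPartialEquiv k, ⟨c, rfl⟩, rfl⟩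

theorem AdaptedChart.mem_jetChart_source (c : AdaptedChart m n π) {k : ℕ} {j : Jet m n π k} :
    j ∈ (c.jetChart k).source ↔ j.toTotal ∈ c.total.source := Iff.rfl

theorem AdaptedChart.truncate_mem_jetChart_target (c : AdaptedChart m n π) {k l : ℕ} (h : l ≤ k)
    {z : JetModel m n k} (hz : z ∈ (c.jetChart k).target) :
    truncate h z ∈ (c.jetChart l).target := hz

theorem AdaptedChart.jetChart_jetProj (c : AdaptedChart m n π) {k l : ℕ} (h : l ≤ k)
    {j : Jet m n π k} (hj : j ∈ (c.jetChart k).source) :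
    c.jetChart l (jetProj m n π h j) = truncate h (c.jetChart k j) := by
  obtain ⟨s, rfl⟩ := j.exists_jet
  have hs : s.toFun s.pt ∈ c.total.source := hj
  have h1 : jetProj m n π h (s.jet k) = s.jet l := rfl
  change c.jetCoord l _ = truncate h (c.jetCoord k _)
  rw [h1, c.jetCoord_jet l s hs, c.jetCoord_jet k s hs]
  rfl

/-- A tangent vector which is vertical for `π^k_l` has vanishing components up to order `l`. -/
theorem AdaptedChart.truncate_chartDeriv_eq_zero (c : AdaptedChart m n π) {k l : ℕ} (h : l ≤ k)
    {j : Jet m n π k} (hj : j ∈ (c.jetChart k).source) {ξ : JetModel m n k}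
    (hξ : mfderiv 𝓘(ℝ, JetModel m n k) 𝓘(ℝ, JetModel m n l) (jetProj m n π h) j ξ = 0) :
    truncate h (chartDeriv (c.jetChart k) j ξ) = 0 := by
  have hk := c.isSmoothChart_jetChart k
  have hl := c.isSmoothChart_jetChart l
  have hsrc : ∀ i ∈ (c.jetChart k).source, jetProj m n π h i ∈ (c.jetChart l).source := by
    intro i hi
    rwa [c.mem_jetChart_source, toTotal_jetProj h]
  have hnhds := (c.jetChart k).open_source.mem_nhds hj
  have h1 : MDifferentiableAt 𝓘(ℝ, JetModel m n k) 𝓘(ℝ, JetModel m n l)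
      (fun i => truncate h (c.jetChart k i)) j :=
    MDifferentiableAt.comp j (g := truncateCLM (m := m) (n := n) h)
      (truncateCLM h).mdifferentiableAt (hk.mdifferentiable.mdifferentiableAt hj)
  have h2 : MDifferentiableAt 𝓘(ℝ, JetModel m n k) 𝓘(ℝ, JetModel m n l) (jetProj m n π h) j := by
    have h3 : jetProj m n π h =ᶠ[𝓝 j] (c.jetChart l).symm ∘
        fun i => truncate h (c.jetChart k i) := by
      filter_upwards [hnhds] with i hi
      simp only [Function.comp, ← c.jetChart_jetProj h hi, (c.jetChart l).left_inv (hsrc i hi)]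
    refine MDifferentiableAt.congr_of_eventuallyEq ?_ h3
    exact (hl.mdifferentiable.mdifferentiableAt_symm (c.truncate_mem_jetChart_target h
      ((c.jetChart k).map_source hj))).comp j h1
  have h4 : (c.jetChart l) ∘ jetProj m n π h =ᶠ[𝓝 j] (truncateCLM h) ∘ c.jetChart k := by
    filter_upwards [hnhds] with i hi
    exact c.jetChart_jetProj h hi
  have h5 := h4.mfderiv_eq (I := 𝓘(ℝ, JetModel m n k)) (I' := 𝓘(ℝ, JetModel m n l))
  rw [mfderiv_comp j (hl.mdifferentiable.mdifferentiableAt (hsrc j hj)) h2,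
    mfderiv_comp j (I' := 𝓘(ℝ, JetModel m n k)) (truncateCLM h).mdifferentiableAt
      (hk.mdifferentiable.mdifferentiableAt hj)] at h5
  have h6 := congrArg (fun q : JetModel m n k →L[ℝ] JetModel m n l => q ξ) h5
  have h7 : mfderiv 𝓘(ℝ, JetModel m n l) 𝓘(ℝ, JetModel m n l) (c.jetChart l)
      (jetProj m n π h j)
      (mfderiv 𝓘(ℝ, JetModel m n k) 𝓘(ℝ, JetModel m n l) (jetProj m n π h) j ξ) =
      mfderiv 𝓘(ℝ, JetModel m n k) 𝓘(ℝ, JetModel m n l) (truncateCLM h) (c.jetChart k j)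
        (chartDeriv (c.jetChart k) j ξ) := h6
  rw [hξ, map_zero, mfderiv_eq_fderiv, ContinuousLinearMap.fderiv] at h7
  exact h7.symm

end JetCharts

/-! ### The Poincaré–Cartan form on the jet manifold -/

section PoincareCartanForm

variable {m n : ℕ} {M : Type u} {E : Type v}
  [TopologicalSpace M] [ChartedSpace (Fin m → ℝ) M]
  [TopologicalSpace E] [ChartedSpace ((Fin m → ℝ) × (Fin n → ℝ)) E] {π : E → M}
  [IsManifold 𝓘(ℝ, Fin m → ℝ) ∞ M] [IsSmoothFiberBundle m n π]

theorem AdaptedChart.contDiffOn_lagrangian (c : AdaptedChart m n π) {L : Jet m n π 2 → ℝ}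
    (hL : ContMDiff 𝓘(ℝ, JetModel m n 2) 𝓘(ℝ, ℝ) ∞ L) :
    ContDiffOn ℝ ∞ (c.lagrangian L) (c.jetChart 2).target := by
  rw [← contMDiffOn_iff_contDiffOn]
  exact hL.comp_contMDiffOn (c.isSmoothChart_jetChart 2).2

theorem AdaptedChart.mfderiv_comp_jetChart (c : AdaptedChart m n π) {k : ℕ}
    {f : JetModel m n k → ℝ} {j : Jet m n π k} (hj : j ∈ (c.jetChart k).source)
    (hf : DifferentiableAt ℝ f (c.jetChart k j)) (ξ : JetModel m n k) :
    mfderiv 𝓘(ℝ, JetModel m n k) 𝓘(ℝ, ℝ) (fun i => f (c.jetChart k i)) j ξ =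
      fderiv ℝ f (c.jetChart k j) (chartDeriv (c.jetChart k) j ξ) := by
  have h := mfderiv_comp j (I' := 𝓘(ℝ, JetModel m n k)) hf.mdifferentiableAt
    ((c.isSmoothChart_jetChart k).mdifferentiable.mdifferentiableAt hj)
  rw [mfderiv_eq_fderiv] at h
  exact congrArg (fun q : JetModel m n k →L[ℝ] ℝ => q ξ) h

/-- At a point of the domain of natural coordinates, `i(ξ)dΘ = 0` for a tangent vector `ξ` vertical
over `J^1π` if and only if the derivatives of the coefficients `L^i_α` and `L^{ij}_α` along `ξ`
vanish. -/
theorem IsPoincareCartanForm.d_cons_eq_zero_iff {vol : DiffForm (Fin m → ℝ) M m}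
    {L : Jet m n π 2 → ℝ} (hL : ContMDiff 𝓘(ℝ, JetModel m n 2) 𝓘(ℝ, ℝ) ∞ L)
    {Θ : DiffForm (JetModel m n 3) (Jet m n π 3) m} (hΘ : IsPoincareCartanForm vol L Θ)
    {c : AdaptedChart m n π} (hc : c.IsNatural vol) {p : Jet m n π 3}
    (hp : p ∈ (c.jetChart 3).source) {ξ : JetModel m n 3}
    (hξ : truncate (by norm_num : 1 ≤ 3) (chartDeriv (c.jetChart 3) p ξ) = 0) :
    (∀ v : Fin m → JetModel m n 3,
      Θ.d p (Fin.cons ξ v : Fin (m + 1) → JetModel m n 3) = 0) ↔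
    (∀ i α, mfderiv 𝓘(ℝ, JetModel m n 3) 𝓘(ℝ, ℝ) (c.Li L i α) p ξ = 0) ∧
    (∀ i j α, mfderiv 𝓘(ℝ, JetModel m n 3) 𝓘(ℝ, ℝ) (c.Lij L i j α) p ξ = 0) := by
  have hz := (c.jetChart 3).map_source hp
  have hz2 : truncate (by norm_num : 2 ≤ 3) (c.jetChart 3 p) ∈ (c.jetChart 2).target :=
    c.truncate_mem_jetChart_target _ hz
  have hopen := (c.jetChart 2).open_target
  have hopen' : IsOpen (truncate (by norm_num : 2 ≤ 3) ⁻¹' (c.jetChart 2).target) :=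
    hopen.preimage (truncateCLM (by norm_num : 2 ≤ 3)).continuous
  have hFs := c.contDiffOn_lagrangian hL
  have hF : DifferentiableAt ℝ (c.lagrangian L) (truncate (by norm_num) (c.jetChart 3 p)) :=
    (hFs.contDiffAt (hopen.mem_nhds hz2)).differentiableAt (by simp)
  have hA : ∀ i α, DifferentiableAt ℝ (coordLi (c.lagrangian L) i α) (c.jetChart 3 p) :=
    fun i α => ((contDiffOn_coordLi hopen hFs i α).contDiffAt
      (hopen'.mem_nhds hz2)).differentiableAt (by simp)
  have hB : ∀ i j α, DifferentiableAt ℝ (fun z : JetModel m n 3 =>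
      coordLij (c.lagrangian L) i j α (truncate (by norm_num) z)) (c.jetChart 3 p) :=
    fun i j α => ((contDiffOn_comp_truncate _ (contDiffOn_coordLij hopen hFs i j α)).contDiffAt
      (hopen'.mem_nhds hz2)).differentiableAt (by simp)
  have hloc : Θ.inChart (c.jetChart 3) =ᶠ[𝓝 (c.jetChart 3 p)] coordTheta (c.lagrangian L) := by
    filter_upwards [(c.jetChart 3).open_target.mem_nhds hz] with z hz
    exact hΘ.2 c hc z hz
  have hchart := c.isSmoothChart_jetChart 3
  have hd : ∀ v : Fin m → JetModel m n 3,
      Θ.d p (Fin.cons ξ v : Fin (m + 1) → JetModel m n 3) =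
        extDeriv (coordTheta (c.lagrangian L)) (c.jetChart 3 p)
          (Fin.cons (chartDeriv (c.jetChart 3) p ξ) fun i => chartDeriv (c.jetChart 3) p (v i) :
            Fin (m + 1) → JetModel m n 3) := by
    intro v
    rw [Θ.d_apply_eq_inChart hchart hp
      ((fderiv_coordTheta hF hA hB hξ).1.congr_of_eventuallyEq hloc), hloc.extDeriv_eq]
    congr 1
    funext i
    refine Fin.cases rfl (fun i => rfl) i
  rw [forall_congr' fun v => by rw [hd v]]
  refine ((hchart.chartDeriv_surjective hp).comp_left.forall (p := fun w : Fin m → JetModel m n 3 =>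
      extDeriv (coordTheta (c.lagrangian L)) (c.jetChart 3 p)
        (Fin.cons (chartDeriv (c.jetChart 3) p ξ) w : Fin (m + 1) → JetModel m n 3) = 0)).symm.trans
      ((extDeriv_coordTheta_cons_eq_zero_iff hF hA hB hξ).trans ?_)
  refine and_congr (forall_congr' fun i => forall_congr' fun α => ?_)
    (forall_congr' fun i => forall_congr' fun j => forall_congr' fun α => ?_)
  · rw [← c.mfderiv_comp_jetChart hp (hA i α) ξ]
    rfl
  · rw [← c.mfderiv_comp_jetChart hp (hB i j α) ξ]
    rfl

/-- `Θ` vanishes on every tuple containing a vector vertical over `J^1π`. -/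
theorem IsPoincareCartanForm.apply_eq_zero {vol : DiffForm (Fin m → ℝ) M m}
    {L : Jet m n π 2 → ℝ} {Θ : DiffForm (JetModel m n 3) (Jet m n π 3) m}
    (hΘ : IsPoincareCartanForm vol L Θ) {c : AdaptedChart m n π} (hc : c.IsNatural vol)
    {p : Jet m n π 3} (hp : p ∈ (c.jetChart 3).source) {v : Fin m → JetModel m n 3} {a : Fin m}
    (hv : truncate (by norm_num : 1 ≤ 3) (chartDeriv (c.jetChart 3) p (v a)) = 0) :
    Θ p v = 0 := by
  rw [Θ.apply_eq_inChart (c.isSmoothChart_jetChart 3) hp, hΘ.2 c hc _ ((c.jetChart 3).map_source hp)]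
  exact coordTheta_eq_zero _ _ hv

theorem truncate_eq_zero_of_le {k l r : ℕ} (h : l ≤ k) (hr : r ≤ l) {w : JetModel m n k}
    (hw : truncate h w = 0) : truncate (hr.trans h) w = 0 := by
  have h1 : w.1 = 0 := congrArg Prod.fst hw
  have h2 := congrArg Prod.snd hw
  exact Prod.ext h1 (funext fun I => congrFun h2 ⟨I.1, I.2.trans hr⟩)

/-- Over a base of dimension zero all jet manifolds coincide. -/
theorem eq_zero_of_truncate_eq_zero {k l : ℕ} (h : l ≤ k) (hm : m = 0) {w : JetModel m n k}
    (hw : truncate h w = 0) : w = 0 := by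
  subst hm
  have h1 : w.1 = 0 := congrArg Prod.fst hw
  have h2 := congrArg Prod.snd hw
  exact Prod.ext h1 (funext fun I => congrFun h2 ⟨I.1, by simp⟩)

/-- Natural coordinates exist around every point, except in the degenerate case `m = 0`, where a
vertical vector is zero. -/
theorem eq_zero_or_exists_isNatural {vol : DiffForm (Fin m → ℝ) M m} (hvol : IsVolumeForm vol)
    {k l : ℕ} (h : l ≤ k) (p : Jet m n π k) {ξ : JetModel m n k}
    (hξ : mfderiv 𝓘(ℝ, JetModel m n k) 𝓘(ℝ, JetModel m n l) (jetProj m n π h) p ξ = 0) :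
    ξ = 0 ∨ ∃ c : AdaptedChart m n π, c.IsNatural vol ∧ p ∈ (c.jetChart k).source := by
  rcases Nat.eq_zero_or_pos m with hm | hm
  · obtain ⟨c, hc⟩ := exists_adaptedChart (m := m) (n := n) (π := π) p.toTotal
    have hp : p ∈ (c.jetChart k).source := c.mem_jetChart_source.2 hc
    refine Or.inl ((c.isSmoothChart_jetChart k).chartDeriv_injective hp ?_)
    rw [map_zero]
    exact eq_zero_of_truncate_eq_zero h hm (c.truncate_chartDeriv_eq_zero h hp hξ)
  · obtain ⟨c, hc, hp⟩ := exists_isNatural (n := n) (π := π) ⟨0, hm⟩ hvol p.toTotal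
    exact Or.inr ⟨c, hc, c.mem_jetChart_source.2 hp⟩

end PoincareCartanForm

theorem lemma1 {m n : ℕ} {M : Type u} {E : Type v}
    [TopologicalSpace M] [T2Space M] [SecondCountableTopology M]
    [ChartedSpace (Fin m → ℝ) M] [IsManifold 𝓘(ℝ, Fin m → ℝ) ∞ M]
    [TopologicalSpace E] [T2Space E] [SecondCountableTopology E]
    [ChartedSpace ((Fin m → ℝ) × (Fin n → ℝ)) E]
    [IsManifold 𝓘(ℝ, (Fin m → ℝ) × (Fin n → ℝ)) ∞ E]
    (π : E → M) [IsSmoothFiberBundle m n π]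
    (vol : DiffForm (Fin m → ℝ) M m) (hvol : IsVolumeForm vol)
    (L : Jet m n π 2 → ℝ) (hL : ContMDiff 𝓘(ℝ, JetModel m n 2) 𝓘(ℝ, ℝ) ∞ L)
    (Θ : DiffForm (JetModel m n 3) (Jet m n π 3) m) (hΘ : IsPoincareCartanForm vol L Θ)
    (s : ℕ) (hs1 : 1 ≤ s) (hs2 : s ≤ 2) :
    List.TFAE [
      Θ.IsProjectable (JetModel m n s) (jetProj m n π (hs2.trans (by norm_num) : s ≤ 3)),
      Θ.d.IsSemibasic (JetModel m n s) (jetProj m n π (hs2.trans (by norm_num) : s ≤ 3)),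
      ∀ c : AdaptedChart m n π, c.IsNatural vol →
        ∀ X : VecField (JetModel m n 3) (Jet m n π 3),
          X.IsVertical (H' := JetModel m n s)
            (jetProj m n π (hs2.trans (by norm_num) : s ≤ 3)) →
          ∀ p ∈ (c.jetChart 3).source,
            (∀ i α, mfderiv 𝓘(ℝ, JetModel m n 3) 𝓘(ℝ, ℝ) (c.Li L i α) p (X p) = 0) ∧
            (∀ i j α, mfderiv 𝓘(ℝ, JetModel m n 3) 𝓘(ℝ, ℝ) (c.Lij L i j α) p (X p) = 0)] := by
  have h3 : s ≤ 3 := hs2.trans (by norm_num)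
  have hvert : ∀ {X : VecField (JetModel m n 3) (Jet m n π 3)},
      X.IsVertical (H' := JetModel m n s) (jetProj m n π h3) →
      ∀ (c : AdaptedChart m n π) {p : Jet m n π 3}, p ∈ (c.jetChart 3).source →
        truncate (by norm_num : 1 ≤ 3) (chartDeriv (c.jetChart 3) p (X p)) = 0 :=
    fun hX c _ hp => truncate_eq_zero_of_le h3 hs1
      (c.truncate_chartDeriv_eq_zero h3 hp (hX.2 _))
  have hΘ0 : ∀ {X : VecField (JetModel m n 3) (Jet m n π 3)},
      X.IsVertical (H' := JetModel m n s) (jetProj m n π h3) →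
      ∀ (p : Jet m n π 3) (v : Fin m → JetModel m n 3), (∃ a, v a = X p) → Θ p v = 0 := by
    rintro X hX p v ⟨a, ha⟩
    obtain h0 | ⟨c, hc, hp⟩ := eq_zero_or_exists_isNatural hvol h3 p (hX.2 p)
    · exact (Θ p).map_coord_zero a (ha.trans h0)
    · exact hΘ.apply_eq_zero hc hp (a := a) (by rw [ha]; exact hvert hX c hp)
  have hint : ∀ X : VecField (JetModel m n 3) (Jet m n π 3), Θ.d.interior X = 0 ↔
      ∀ (p : Jet m n π 3) (v : Fin m → JetModel m n 3),
        Θ.d p (Fin.cons (X p) v : Fin (m + 1) → JetModel m n 3) = 0 := by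
    intro X
    refine ⟨fun h p v => ?_, fun h => funext fun p => ?_⟩
    · exact congrArg (fun τ : JetModel m n 3 [⋀^Fin m]→L[ℝ] ℝ => τ v) (congrFun h p)
    · exact ContinuousAlternatingMap.ext fun v => h p v
  tfae_have 1 ↔ 2 := by
    refine forall_congr' fun X => forall_congr' fun hX => ?_
    rw [hint]
    have hLie := DiffForm.lieDeriv_eq_d hΘ.1 hX.1 (hΘ0 hX)
    constructor
    · intro h p v
      rw [← hLie]
      exact h.2 p v
    · refine fun h => ⟨?_, fun p v => (hLie p v).trans (h p v)⟩
      cases m with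
      | zero => rfl
      | succ m =>
        exact funext fun p => ContinuousAlternatingMap.ext fun v => hΘ0 hX p _ ⟨0, rfl⟩
  tfae_have 2 → 3 := by
    intro h c hc X hX p hp
    exact (hΘ.d_cons_eq_zero_iff hL hc hp (hvert hX c hp)).1 ((hint X).1 (h X hX) p)
  tfae_have 3 → 2 := by
    intro h X hX
    refine (hint X).2 fun p => ?_
    obtain h0 | ⟨c, hc, hp⟩ := eq_zero_or_exists_isNatural hvol h3 p (hX.2 p)
    · exact fun v => (Θ.d p).map_coord_zero 0 h0
    · exact (hΘ.d_cons_eq_zero_iff hL hc hp (hvert hX c hp)).2 (h c hc X hX p hp)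
  tfae_finish
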